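/- Let $\mathcal C$ be the complete curve with affine equation $y^2=\mathcal P(x)=x^5+\lambda_2x^4+\lambda_4x^3+\lambda_6x^2+\lambda_8x+\lambda_{10}$ over $\mathbb C$, where $\mathcal P$ has no repeated roots, with its single point at infinity $\infty$. Let $\mathrm{Jac}(\mathcal C)$ be the group of divisors of degree $0$ modulo linear equivalence, and write $[D]=D-(\deg D)\,\infty\in\mathrm{Jac}(\mathcal C)$. A class is called non-special if it equals $[P_1+P_2]$ with $P_1,P_2$ finite points that are not exchanged by the involution $(x,y)\mapsto(x,-y)$ (that is, $P_2\neq -P_1$), and special if it equals $[P_1+\infty]$ with $P_1$ finite. A divisor $D$ is $4$-torsion if $[D]$ has order exactly $4$. Let $D=(x_1,y_1)+(x_2,y_2)$ with $(x_1,y_1),(x_2,y_2)$ finite points of $\mathcal C$ and $x_1\ne x_2$. Put $$\alpha_2=-(x_1+x_2),\quad \alpha_4=x_1x_2,\quad \beta_3=-\frac{y_1-y_2}{x_1-x_2},\quad \beta_5=\frac{x_2y_1-x_1y_2}{x_1-x_2},$$ and, when $y_1,y_2\ne0$, put $y_i'=\mathcal P'(x_i)/(2y_i)$ and $$\beta_3'=-\frac{y_1'-y_2'}{x_1-x_2},\quad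 \beta_5'=\frac{y_1'x_2-y_2'x_1}{x_1-x_2}+\frac{y_1-y_2}{x_1-x_2},\quad \Delta=2\beta_5'-\alpha_2\beta_3'.$$ (1) Suppose $2D$ is non-special. If $y_1,y_2\neq 0$, then $\Delta\ne0$. The divisor $D$ is $4$-torsion if and only if $y_1\ne0$, $y_2\neq0$ and $$-2\alpha_4-\alpha_2^2+(2\alpha_2-\gamma_2+\gamma_1^2)(\gamma_2-\gamma_1^2)+\gamma_1^2(\gamma_2-\lambda_2)+\gamma_4=0,$$ $$\big(-2\alpha_4+(3\alpha_2-\gamma_2)(\alpha_2-\gamma_2)+\gamma_1^2(2\alpha_2-\lambda_2)+2\gamma_4\big)(2\alpha_2-\gamma_2+\gamma_1^2)=\gamma_6,$$ where $$\gamma_1=\frac{\alpha_2^2-4\alpha_4}{\Delta},\quad \gamma_2=\frac{3\alpha_2\beta_5'-(\alpha_2^2+2\alpha_4)\beta_3'}{\Delta},$$ $$\gamma_4=\alpha_2\gamma_2+\beta_3\gamma_1-(\alpha_2^2-\alpha_4),\quad \gamma_6=\alpha_4\gamma_2+\beta_5\gamma_1-\alpha_2\alpha_4.$$ (2) Suppose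 $2D$ is special. Then $y_1,y_2\ne0$ and $\Delta=0$, and $D$ is $4$-torsion if and only if $$\big(\gamma_1(2\alpha_2+\gamma_1^2-\lambda_2)+\gamma_3\big)(2\alpha_2+\gamma_1^2-\lambda_2)+\gamma_5=0,$$ where $\gamma_1=\tfrac12\beta_3'$, $\gamma_3=\tfrac12(2\beta_3+\alpha_2\beta_3')$, $\gamma_5=\tfrac12(2\beta_5+\alpha_4\beta_3')$. (3) $\mathrm{Jac}(\mathcal C)$ has exactly $240$ points of order $4$. Each of them is $[D]$ for exactly one divisor $D=P_1+P_2$ with $P_1,P_2$ finite and $P_2\ne-P_1$, and its double is either non-special or special, but not both. The double is non-special for $160$ of the points, and special for $80$ of them. Consequently, for every isomorphism $u$ from the group of characteristics $[\varepsilon]=(\varepsilon',\varepsilon)\in(\mathbb R/\mathbb Z)^2\times(\mathbb R/\mathbb Z)^2$ onto $\mathrm{Jac}(\mathcal C)$ (for instance the one given by $\omega\varepsilon+\omega'\varepsilon'$ with period matrices $\omega,\omega'$ and the Abel map), there are $240$ characteristics of order $4$; $u[2\varepsilon]$ is non-special for $160$ of them and special for $80$. -/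

import Mathlib

open Polynomial

/-- Parameters `λ = (λ₂, λ₄, λ₆, λ₈, λ₁₀)` of the curve
`y² = x⁵ + λ₂ x⁴ + λ₄ x³ + λ₆ x² + λ₈ x + λ₁₀` over `ℂ`. -/
structure Genus2 where
  l2 : ℂ
  l4 : ℂ
  l6 : ℂ
  l8 : ℂ
  l10 : ℂ

namespace Genus2

noncomputable section

/-- The polynomial `𝒫(x)` on the right-hand side of the equation of the curve. -/
def poly (L : Genus2) : ℂ[X] :=
  X ^ 5 + C L.l2 * X ^ 4 + C L.l4 * X ^ 3 + C L.l6 * X ^ 2 + C L.l8 * X + C L.l10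

/-- The curve is not degenerate (its genus is `2`): `𝒫` has no repeated roots. -/
def Nondegenerate (L : Genus2) : Prop := Squarefree L.poly

/-- Finite points of the curve. -/
@[ext]
structure AffinePoint (L : Genus2) where
  x : ℂ
  y : ℂ
  eqn : y ^ 2 = L.poly.eval x

/-- The hyperelliptic involution on the finite points. -/
def AffinePoint.invol {L : Genus2} (P : L.AffinePoint) : L.AffinePoint :=
  ⟨P.x, -P.y, by rw [neg_sq, P.eqn]⟩

/-- Points of the complete curve: the finite points and the single point at infinity. -/
inductive Point (L : Genus2) where
  | infinity : Point L
  | affine (P : L.AffinePoint) : Point L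

/-- The ring `ℂ[x, y] / (y² - 𝒫(x))` of polynomial functions on the curve. -/
abbrev CoordRing (L : Genus2) : Type := AdjoinRoot (X ^ 2 - C L.poly : ℂ[X][X])

/-- The polynomial function `a(x) + b(x) y`; every polynomial function is uniquely of this form. -/
def func (L : Genus2) (a b : ℂ[X]) : L.CoordRing :=
  AdjoinRoot.of (X ^ 2 - C L.poly : ℂ[X][X]) a +
    AdjoinRoot.of (X ^ 2 - C L.poly : ℂ[X][X]) b * AdjoinRoot.root (X ^ 2 - C L.poly : ℂ[X][X])

/-- The maximal ideal `(x - x_P, y - y_P)` of a finite point `P`. -/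
def AffinePoint.ideal {L : Genus2} (P : L.AffinePoint) : Ideal L.CoordRing :=
  Ideal.span {L.func (X - C P.x) 0, L.func (-C P.y) 1}

/-- The Sato weight of `a(x) + b(x) y`, with `wgt x = 2` and `wgt y = 5`: the order of its pole
at infinity. -/
def weight (a b : ℂ[X]) : ℕ :=
  max (2 * a.natDegree) (if b = 0 then 0 else 2 * b.natDegree + 5)

/-- Divisors on the complete curve. -/
abbrev Divisor (L : Genus2) : Type := L.Point →₀ ℤ

/-- The degree of a divisor. -/
def degree (L : Genus2) : L.Divisor →+ ℤ :=
  Finsupp.liftAddHom fun _ => AddMonoidHom.id ℤ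

/-- `D` is the divisor of the polynomial function `a(x) + b(x) y`: at a finite point `P` its
coefficient is the order of vanishing, and at infinity it is minus the weight. -/
def IsDivisorOf {L : Genus2} (D : L.Divisor) (a b : ℂ[X]) : Prop :=
  (∀ P : L.AffinePoint, ∃ n : ℕ, D (Point.affine P) = (n : ℤ) ∧
      L.func a b ∈ P.ideal ^ n ∧ L.func a b ∉ P.ideal ^ (n + 1)) ∧
    D Point.infinity = -(weight a b : ℤ)

/-- The group of principal divisors. Every non-zero rational function is a quotient of two non-zero
polynomial functions, so it is generated by the divisors of the latter. -/
def principal (L : Genus2) : AddSubgroup L.Divisor :=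
  AddSubgroup.closure {D | ∃ a b : ℂ[X], ¬(a = 0 ∧ b = 0) ∧ IsDivisorOf D a b}

/-- The Jacobian of the curve: divisors of degree zero modulo linear equivalence. -/
abbrev Jac (L : Genus2) : Type := L.degree.ker ⧸ L.principal.addSubgroupOf L.degree.ker

theorem degree_sub_infinity {L : Genus2} (D : L.Divisor) :
    D - Finsupp.single Point.infinity (L.degree D) ∈ L.degree.ker := by
  rw [AddMonoidHom.mem_ker, map_sub]
  have h : ∀ n : ℤ, L.degree (Finsupp.single Point.infinity n) = n := fun n =>
    Finsupp.liftAddHom_apply_single _ _ _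
  rw [h, sub_self]

/-- The point `[D - (deg D) ∞]` of the Jacobian represented by `D`. -/
def jacClass {L : Genus2} (D : L.Divisor) : L.Jac :=
  QuotientAddGroup.mk ⟨D - Finsupp.single Point.infinity (L.degree D), degree_sub_infinity D⟩

/-- The divisor `P + Q` of degree two. -/
def pair {L : Genus2} (P Q : L.AffinePoint) : L.Divisor :=
  Finsupp.single (Point.affine P) 1 + Finsupp.single (Point.affine Q) 1

/-- Non-special divisors of degree two: `P + Q` with `P`, `Q` finite and not in involution. -/
def IsNonSpecialDivisor {L : Genus2} (D : L.Divisor) : Prop :=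
  ∃ P Q : L.AffinePoint, Q ≠ P.invol ∧ D = pair P Q

/-- The reduced divisor of the class `c` is non-special, of degree two. -/
def IsNonSpecial {L : Genus2} (c : L.Jac) : Prop :=
  ∃ D : L.Divisor, IsNonSpecialDivisor D ∧ c = jacClass D

/-- The reduced divisor of the class `c` is special, of the form `P + ∞` with `P` finite. -/
def IsSpecial {L : Genus2} (c : L.Jac) : Prop :=
  ∃ P : L.AffinePoint,
    c = jacClass (Finsupp.single (Point.affine P) 1 + Finsupp.single Point.infinity 1)

/-- `D` is an `n`-torsion divisor: its class generates a cyclic group of order `n`. -/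
def IsTorsionDivisor {L : Genus2} (n : ℕ) (D : L.Divisor) : Prop :=
  0 < n ∧ addOrderOf (jacClass D) = n

section Coordinates

variable {L : Genus2} (P Q : L.AffinePoint)

/-- The Mumford coordinate `α₂ = -(x_P + x_Q)` of `P + Q`. The four coordinates are the coefficients
of the functions `x² + α₂ x + α₄` and `y + β₃ x + β₅`, whose common zeros are `P` and `Q`. -/
def alpha2 : ℂ := -(P.x + Q.x)

/-- The Mumford coordinate `α₄ = x_P x_Q`. -/
def alpha4 : ℂ := P.x * Q.x

/-- The Mumford coordinate `β₃` (for `x_P ≠ x_Q`). -/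
def beta3 : ℂ := -((P.y - Q.y) / (P.x - Q.x))

/-- The Mumford coordinate `β₅` (for `x_P ≠ x_Q`). -/
def beta5 : ℂ := (Q.x * P.y - P.x * Q.y) / (P.x - Q.x)

/-- The derivative `y' = 𝒫'(x) / (2 y)` of `y` along the curve (for `y ≠ 0`). -/
def AffinePoint.slope : ℂ := L.poly.derivative.eval P.x / (2 * P.y)

/-- The derivative of `β₃` along `d/dx_P + d/dx_Q` (for `x_P ≠ x_Q`, `y_P ≠ 0`, `y_Q ≠ 0`). -/
def dbeta3 : ℂ := -((P.slope - Q.slope) / (P.x - Q.x))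

/-- The derivative of `β₅` along `d/dx_P + d/dx_Q` (for `x_P ≠ x_Q`, `y_P ≠ 0`, `y_Q ≠ 0`). -/
def dbeta5 : ℂ :=
  (P.slope * Q.x - Q.slope * P.x) / (P.x - Q.x) + (P.y - Q.y) / (P.x - Q.x)

/-- The denominator of the duplication law. -/
def den : ℂ := 2 * dbeta5 P Q - alpha2 P Q * dbeta3 P Q

/-- The coefficient `γ₁` of the duplication law; the `γ_k` are the coefficients of the function
`x³ + γ₁ y + γ₂ x² + γ₄ x + γ₆` that vanishes on `2(P + Q)`. -/
def gamma1 : ℂ := (alpha2 P Q ^ 2 - 4 * alpha4 P Q) / den P Q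

/-- The coefficient `γ₂` of the duplication law. -/
def gamma2 : ℂ :=
  (3 * alpha2 P Q * dbeta5 P Q - (alpha2 P Q ^ 2 + 2 * alpha4 P Q) * dbeta3 P Q) / den P Q

/-- The coefficient `γ₄` of the duplication law. -/
def gamma4 : ℂ :=
  alpha2 P Q * gamma2 P Q + beta3 P Q * gamma1 P Q - (alpha2 P Q ^ 2 - alpha4 P Q)

/-- The coefficient `γ₆` of the duplication law. -/
def gamma6 : ℂ :=
  alpha4 P Q * gamma2 P Q + beta5 P Q * gamma1 P Q - alpha2 P Q * alpha4 P Q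

/-- The coefficient `γ₁` when `2(P + Q)` is special; in that case the `γ_k` are the coefficients of
the function `y + γ₁ x² + γ₃ x + γ₅` that vanishes on `2(P + Q)`. -/
def gammaS1 : ℂ := dbeta3 P Q / 2

/-- The coefficient `γ₃` when `2(P + Q)` is special. -/
def gammaS3 : ℂ := (2 * beta3 P Q + alpha2 P Q * dbeta3 P Q) / 2

/-- The coefficient `γ₅` when `2(P + Q)` is special. -/
def gammaS5 : ℂ := (2 * beta5 P Q + alpha4 P Q * dbeta3 P Q) / 2

end Coordinates

/-- The two division polynomial equations for 4-torsion divisors `P + Q` with `2(P + Q)`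
non-special. -/
def FourTorsionEqs {L : Genus2} (P Q : L.AffinePoint) : Prop :=
  -2 * alpha4 P Q - alpha2 P Q ^ 2
      + (2 * alpha2 P Q - gamma2 P Q + gamma1 P Q ^ 2) * (gamma2 P Q - gamma1 P Q ^ 2)
      + gamma1 P Q ^ 2 * (gamma2 P Q - L.l2) + gamma4 P Q = 0 ∧
  (-2 * alpha4 P Q + (3 * alpha2 P Q - gamma2 P Q) * (alpha2 P Q - gamma2 P Q)
      + gamma1 P Q ^ 2 * (2 * alpha2 P Q - L.l2) + 2 * gamma4 P Q)
      * (2 * alpha2 P Q - gamma2 P Q + gamma1 P Q ^ 2) = gamma6 P Q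

/-- The division polynomial equation for 4-torsion divisors `P + Q` with `2(P + Q)` special. -/
def FourTorsionEqSpecial {L : Genus2} (P Q : L.AffinePoint) : Prop :=
  (gammaS1 P Q * (2 * alpha2 P Q + gammaS1 P Q ^ 2 - L.l2) + gammaS3 P Q)
      * (2 * alpha2 P Q + gammaS1 P Q ^ 2 - L.l2) + gammaS5 P Q = 0

/-- Characteristics `[ε] = (ε', ε)`: pairs of vectors in `(ℝ/ℤ)²`. -/
abbrev Characteristic : Type := (Fin 2 → UnitAddCircle) × (Fin 2 → UnitAddCircle)

end

end Genus2

namespace Genus2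

noncomputable section

variable {L : Genus2}

/-! ### The coordinate ring -/

/-! The polynomial functions on the finite part of the curve form a Dedekind domain whose nonzero
primes are exactly the ideals of finite points (`exists_eq_ideal`,
`Nondegenerate.isDedekindDomain`). Effective finite divisors are thus the nonzero ideals, and
`sum_cls_eq_zero_iff` turns linear equivalence into principality of an ideal. Infinity takes care of
itself: the order of the pole there is the degree of the norm `a² - b² 𝒫`, which is the number of
finite zeros.

Since `y` has weight 5, a function with at most four zeros is a polynomial in `x`, and the
involution exchanges its zeros in pairs (`invol_mem_of_sum_cls_eq_zero`). This makes reduced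
divisors unique; a dimension count in weight at most 5 shows that they exist. So every class is
exactly one of zero, special, non-special.

For the criteria, interpolate the curve to second order at `P` and `Q`. If `Δ = 0` the graph of a
quadratic does this and meets the curve in one more point; if `Δ ≠ 0` a cubic is needed and there
are two more points. The class of `2D` is minus that of the residual points, so `4D` is trivial
exactly when these are branch points, and comparing coefficients expresses their abscissae in the
`γ_k`.

For the count, the five branch points give 5 special and `5.choose 2 = 10` non-special classes of
order two, so with zero the 2-torsion has 16 elements. Doubling is surjective, because every `[P -
∞]` has an explicit half; all its fibres have 16 elements, whence `10 * 16` and `5 * 16`. -/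

theorem natDegree_poly (L : Genus2) : L.poly.natDegree = 5 := by
  unfold poly; compute_degree!

theorem monic_poly (L : Genus2) : L.poly.Monic := by
  unfold poly; monicity!

theorem poly_ne_zero (L : Genus2) : L.poly ≠ 0 := L.monic_poly.ne_zero

/-- The function `y` on the curve. -/
abbrev yfun (L : Genus2) : L.CoordRing := AdjoinRoot.root (X ^ 2 - C L.poly : ℂ[X][X])

/-- A polynomial in `x`, as a function on the curve. -/
abbrev xfun (L : Genus2) : ℂ[X] →+* L.CoordRing := AdjoinRoot.of (X ^ 2 - C L.poly : ℂ[X][X])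

theorem func_def (a b : ℂ[X]) : L.func a b = L.xfun a + L.xfun b * L.yfun := rfl

theorem func_zero_right (a : ℂ[X]) : L.func a 0 = L.xfun a := by simp [func_def]

theorem yfun_sq (L : Genus2) : L.yfun ^ 2 = L.xfun L.poly := by
  have h := AdjoinRoot.eval₂_root (X ^ 2 - C L.poly : ℂ[X][X])
  simpa [eval₂_sub, sub_eq_zero] using h

theorem func_add (a b c d : ℂ[X]) : L.func a b + L.func c d = L.func (a + c) (b + d) := by
  simp only [func_def, map_add]; ring

theorem func_mul (a b c d : ℂ[X]) :
    L.func a b * L.func c d = L.func (a * c + b * d * L.poly) (a * d + b * c) := by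
  simp only [func_def, map_add, map_mul, ← yfun_sq]; ring

theorem exists_func (h : L.CoordRing) : ∃ a b : ℂ[X], h = L.func a b := by
  have hm : (X ^ 2 - C L.poly : ℂ[X][X]).Monic := by monicity!
  have hd : (X ^ 2 - C L.poly : ℂ[X][X]).natDegree = 2 := by compute_degree!
  induction h using AdjoinRoot.induction_on with
  | ih p =>
    have h1 : AdjoinRoot.mk (X ^ 2 - C L.poly) p = AdjoinRoot.mk _ (p %ₘ (X ^ 2 - C L.poly)) := by
      rw [AdjoinRoot.mk_eq_mk]
      exact ⟨p /ₘ (X ^ 2 - C L.poly), by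
        rw [sub_eq_iff_eq_add, add_comm, modByMonic_add_div]⟩
    have h2 : (p %ₘ (X ^ 2 - C L.poly)).natDegree ≤ 1 := by
      have := natDegree_modByMonic_lt p hm (by intro h; rw [h] at hd; simp at hd)
      omega
    obtain ⟨b, a, h3⟩ := exists_eq_X_add_C_of_natDegree_le_one h2
    refine ⟨a, b, ?_⟩
    rw [h1, h3, func_def]
    simp [add_comm]

/-- The norm of `a + b y` over `ℂ[x]`. -/
def normPoly (L : Genus2) (a b : ℂ[X]) : ℂ[X] := a ^ 2 - b ^ 2 * L.poly

theorem func_mul_conj (a b : ℂ[X]) : L.func a b * L.func a (-b) = L.xfun (L.normPoly a b) := by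
  rw [func_mul, ← func_zero_right, normPoly]; congr 1 <;> ring

theorem natDegree_sq_mul_poly {b : ℂ[X]} (hb : b ≠ 0) :
    (b ^ 2 * L.poly).natDegree = 2 * b.natDegree + 5 := by
  rw [natDegree_mul (pow_ne_zero 2 hb) L.poly_ne_zero, natDegree_pow, natDegree_poly]

/-- The degrees of `a²` and `b² 𝒫` have opposite parity, so the leading terms cannot cancel. -/
theorem natDegree_normPoly (a b : ℂ[X]) : (L.normPoly a b).natDegree = weight a b := by
  unfold normPoly weight
  by_cases hb : b = 0
  · simp [hb]
  · rw [if_neg hb]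
    have h1 := natDegree_sq_mul_poly (L := L) hb
    have h2 : (a ^ 2).natDegree = 2 * a.natDegree := natDegree_pow a 2
    rcases lt_or_ge (2 * a.natDegree) (2 * b.natDegree + 5) with h | h
    · rw [natDegree_sub_eq_right_of_natDegree_lt (by omega), h1, max_eq_right h.le]
    · rw [natDegree_sub_eq_left_of_natDegree_lt (by omega), h2, max_eq_left h]

theorem normPoly_ne_zero {a b : ℂ[X]} (h : ¬(a = 0 ∧ b = 0)) : L.normPoly a b ≠ 0 := by
  intro h0
  unfold normPoly at h0
  rw [sub_eq_zero] at h0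
  by_cases hb : b = 0
  · simp [hb] at h0; exact h ⟨h0, hb⟩
  · have h1 := natDegree_sq_mul_poly (L := L) hb
    have h2 : (a ^ 2).natDegree = 2 * a.natDegree := natDegree_pow a 2
    rw [h0, h1] at h2
    omega

theorem xfun_injective (L : Genus2) : Function.Injective L.xfun := by
  refine AdjoinRoot.of.injective_of_degree_ne_zero ?_
  have hd : (X ^ 2 - C L.poly : ℂ[X][X]).degree = 2 := by compute_degree!
  rw [hd]; norm_num

theorem func_eq_zero_iff {a b : ℂ[X]} : L.func a b = 0 ↔ a = 0 ∧ b = 0 := by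
  refine ⟨fun h => ?_, fun h => by simp [func_def, h.1, h.2]⟩
  by_contra h1
  have h2 := func_mul_conj (L := L) a b
  rw [h, zero_mul] at h2
  exact normPoly_ne_zero h1 (L.xfun_injective (by rw [← h2, map_zero]))

theorem func_injective {a b c d : ℂ[X]} (h : L.func a b = L.func c d) : a = c ∧ b = d := by
  have h1 : L.func (a - c) (b - d) = 0 := by
    have : L.func (a - c) (b - d) = L.func a b - L.func c d := by
      simp only [func_def, map_sub]; ring
    rw [this, h, sub_self]
  simpa [sub_eq_zero] using func_eq_zero_iff.1 h1

instance : Nontrivial L.CoordRing := L.xfun_injective.nontrivial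

instance : IsDomain L.CoordRing := by
  have : NoZeroDivisors L.CoordRing := ⟨fun {g h} hgh => by
    obtain ⟨a, b, rfl⟩ := exists_func g
    obtain ⟨c, d, rfl⟩ := exists_func h
    by_contra! h0
    rw [Ne, Ne, func_eq_zero_iff, func_eq_zero_iff] at h0
    refine mul_ne_zero (normPoly_ne_zero (L := L) h0.1) (normPoly_ne_zero (L := L) h0.2) ?_
    refine L.xfun_injective ?_
    rw [map_mul, map_zero, ← func_mul_conj, ← func_mul_conj]
    linear_combination (L.func a (-b) * L.func c (-d)) * hgh⟩
  exact NoZeroDivisors.to_isDomain _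

/-! ### The maximal ideals of points -/

namespace AffinePoint

/-- Evaluation of functions at a point. -/
def eval (P : L.AffinePoint) : L.CoordRing →+* ℂ :=
  AdjoinRoot.lift (evalRingHom P.x) P.y (by simp [eval₂_sub, P.eqn])

@[simp] theorem eval_xfun (P : L.AffinePoint) (a : ℂ[X]) : P.eval (L.xfun a) = a.eval P.x := by
  simp [eval]

@[simp] theorem eval_yfun (P : L.AffinePoint) : P.eval L.yfun = P.y := by
  simp [eval]

@[simp] theorem eval_func (P : L.AffinePoint) (a b : ℂ[X]) :
    P.eval (L.func a b) = a.eval P.x + b.eval P.x * P.y := by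
  simp [func_def]

theorem ideal_eq (P : L.AffinePoint) :
    P.ideal = Ideal.span {L.xfun (X - C P.x), L.yfun - L.xfun (C P.y)} := by
  rw [ideal, func_zero_right, func_def]
  congr 3
  simp only [map_neg, map_one]; ring

theorem mem_ideal_iff (P : L.AffinePoint) {h : L.CoordRing} : h ∈ P.ideal ↔ P.eval h = 0 := by
  constructor
  · intro hh
    have : P.ideal ≤ RingHom.ker P.eval := by
      rw [ideal_eq, Ideal.span_le]
      rintro g (rfl | rfl) <;> simp [RingHom.mem_ker]
    exact this hh
  · intro hh
    obtain ⟨a, b, rfl⟩ := exists_func h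
    rw [eval_func] at hh
    obtain ⟨a', ha⟩ := X_sub_C_dvd_sub_C_eval (a := P.x) (p := a)
    obtain ⟨b', hb⟩ := X_sub_C_dvd_sub_C_eval (a := P.x) (p := b)
    rw [ideal_eq, Ideal.mem_span_pair]
    refine ⟨L.xfun a' + L.xfun b' * L.yfun, L.xfun (C (b.eval P.x)), ?_⟩
    have h1 : L.xfun (C (a.eval P.x)) + L.xfun (C (b.eval P.x)) * L.xfun (C P.y) = 0 := by
      rw [← map_mul, ← map_add, ← C_mul, ← C_add, hh]; simp
    have ha' := congrArg L.xfun ha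
    have hb' := congrArg L.xfun hb
    rw [map_sub, map_mul] at ha' hb'
    rw [func_def]
    linear_combination (-1) * ha' - L.yfun * hb' - h1

theorem ideal_eq_ker (P : L.AffinePoint) : P.ideal = RingHom.ker P.eval :=
  Ideal.ext fun _ => P.mem_ideal_iff

theorem eval_C (P : L.AffinePoint) (c : ℂ) : P.eval (L.xfun (C c)) = c := by simp

instance ideal_isMaximal (P : L.AffinePoint) : P.ideal.IsMaximal := by
  rw [ideal_eq_ker]
  exact RingHom.ker_isMaximal_of_surjective _ fun c => ⟨_, P.eval_C c⟩

theorem ideal_ne_bot (P : L.AffinePoint) : P.ideal ≠ ⊥ := by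
  intro h
  have h1 : L.xfun (X - C P.x) ∈ P.ideal := by simp [mem_ideal_iff]
  rw [h, Ideal.mem_bot, map_eq_zero_iff _ L.xfun_injective] at h1
  exact X_sub_C_ne_zero _ h1

theorem ideal_injective : Function.Injective (ideal : L.AffinePoint → Ideal L.CoordRing) := by
  intro P Q h
  have h1 : L.xfun (X - C P.x) ∈ Q.ideal := by rw [← h]; simp [mem_ideal_iff]
  have h2 : L.yfun - L.xfun (C P.y) ∈ Q.ideal := by rw [← h]; simp [mem_ideal_iff]
  rw [mem_ideal_iff] at h1 h2
  simp [sub_eq_zero] at h1 h2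
  exact AffinePoint.ext h1.symm h2.symm

@[simp] theorem invol_x (P : L.AffinePoint) : P.invol.x = P.x := rfl
@[simp] theorem invol_y (P : L.AffinePoint) : P.invol.y = -P.y := rfl
@[simp] theorem invol_invol (P : L.AffinePoint) : P.invol.invol = P := by
  ext <;> simp

theorem invol_eq_self_iff (P : L.AffinePoint) : P.invol = P ↔ P.y = 0 := by
  rw [AffinePoint.ext_iff]
  simp [neg_eq_self]

theorem eq_or_eq_invol {P Q : L.AffinePoint} (h : P.x = Q.x) : Q = P ∨ Q = P.invol := by
  have h1 : Q.y ^ 2 = P.y ^ 2 := by rw [P.eqn, Q.eqn, h]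
  rcases sq_eq_sq_iff_eq_or_eq_neg.1 h1 with h2 | h2
  · exact Or.inl (AffinePoint.ext h.symm h2)
  · exact Or.inr (AffinePoint.ext h.symm h2)

/-- There is a point over every `x`. -/
theorem exists_x_eq (L : Genus2) (a : ℂ) : ∃ P : L.AffinePoint, P.x = a := by
  obtain ⟨y, hy⟩ := IsAlgClosed.exists_pow_nat_eq (L.poly.eval a) two_pos
  exact ⟨⟨a, y, hy⟩, rfl⟩

end AffinePoint

/-- A nonzero prime contains a nonzero norm, which is a polynomial in `x` and splits, so it contains
some `x - c`. Modulo `x - c` the equation of the curve factors as `(y - y_P)(y + y_P) = 0`, which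
leaves two candidates, both maximal. -/
theorem exists_eq_ideal {I : Ideal L.CoordRing} (hI : I.IsPrime) (h0 : I ≠ ⊥) :
    ∃ P : L.AffinePoint, I = P.ideal := by
  obtain ⟨h, hh, hne⟩ := Submodule.exists_mem_ne_zero_of_ne_bot h0
  obtain ⟨a, b, rfl⟩ := exists_func h
  have h1 : L.xfun (L.normPoly a b) ∈ I := by
    rw [← func_mul_conj]; exact I.mul_mem_right _ hh
  have h2 : L.normPoly a b ≠ 0 := normPoly_ne_zero (by rwa [Ne, func_eq_zero_iff] at hne)
  have h3 : ∃ c, L.xfun (X - C c) ∈ I := by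
    have hs := IsAlgClosed.splits (L.normPoly a b)
    rw [hs.eq_prod_roots, map_mul] at h1
    rcases hI.mem_or_mem h1 with h4 | h4
    · exfalso
      refine hI.ne_top (Ideal.eq_top_of_isUnit_mem _ h4 ?_)
      refine IsUnit.map _ (isUnit_C.2 (isUnit_iff_ne_zero.2 (leadingCoeff_ne_zero.2 h2)))
    · rw [map_multiset_prod, hI.multiset_prod_mem_iff_exists_mem] at h4
      obtain ⟨p, hp, hpI⟩ := h4
      simp only [Multiset.map_map, Multiset.mem_map] at hp
      obtain ⟨c, -, rfl⟩ := hp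
      exact ⟨c, hpI⟩
  obtain ⟨c, hc⟩ := h3
  obtain ⟨P, rfl⟩ := AffinePoint.exists_x_eq L c
  have h4 : (L.yfun - L.xfun (C P.y)) * (L.yfun - L.xfun (C P.invol.y)) ∈ I := by
    obtain ⟨k, hk⟩ := X_sub_C_dvd_sub_C_eval (a := P.x) (p := L.poly)
    have : (L.yfun - L.xfun (C P.y)) * (L.yfun - L.xfun (C P.invol.y)) =
        L.xfun (X - C P.x) * L.xfun k := by
      rw [← map_mul, ← hk, ← P.eqn]
      simp only [AffinePoint.invol_y, map_neg, map_sub, map_pow, ← yfun_sq]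
      ring
    rw [this]
    exact I.mul_mem_right _ hc
  rcases hI.mem_or_mem h4 with h5 | h5
  · refine ⟨P, (P.ideal_isMaximal.eq_of_le hI.ne_top ?_).symm⟩
    rw [P.ideal_eq, Ideal.span_le]
    rintro g (rfl | rfl) <;> assumption
  · refine ⟨P.invol, (P.invol.ideal_isMaximal.eq_of_le hI.ne_top ?_).symm⟩
    rw [P.invol.ideal_eq, Ideal.span_le]
    rintro g (rfl | rfl) <;> assumption

/-! ### The coordinate ring is a Dedekind domain -/

theorem Nondegenerate.not_sq_dvd (hL : L.Nondegenerate) (a : ℂ) : ¬ (X - C a) ^ 2 ∣ L.poly := by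
  intro h
  rw [sq] at h
  exact not_isUnit_X_sub_C a (hL _ h)

theorem Nondegenerate.exists_eq_mul (hL : L.Nondegenerate) {a : ℂ} (ha : L.poly.eval a = 0) :
    ∃ k : ℂ[X], L.poly = (X - C a) * k ∧ k.eval a ≠ 0 := by
  obtain ⟨k, hk⟩ := dvd_iff_isRoot.2 (show L.poly.IsRoot a from ha)
  refine ⟨k, hk, fun h => ?_⟩
  obtain ⟨l, hl⟩ := dvd_iff_isRoot.2 (show k.IsRoot a from h)
  exact hL.not_sq_dvd a ⟨l, by rw [hk, hl]; ring⟩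

/-- Smoothness at `P`: after inverting `s`, the ideal of `P` is generated by `p`. At a branch point
`p = y`, since `y² = (x - x_P) k` and `k(x_P) ≠ 0` because the root is simple; elsewhere `p = x -
x_P`, since `(y + y_P)(y - y_P)` is divisible by it. -/
theorem AffinePoint.exists_uniformizer (hL : L.Nondegenerate) (P : L.AffinePoint) :
    ∃ p ∈ P.ideal, ∃ s ∉ P.ideal, ∀ h ∈ P.ideal, s * h ∈ Ideal.span {p} := by
  have key : ∀ p s : L.CoordRing, s * L.xfun (X - C P.x) ∈ Ideal.span {p} →
      s * (L.yfun - L.xfun (C P.y)) ∈ Ideal.span {p} →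
      ∀ h ∈ P.ideal, s * h ∈ Ideal.span {p} := by
    intro p s h1 h2 h hh
    rw [ideal_eq, Ideal.mem_span_pair] at hh
    obtain ⟨u, v, rfl⟩ := hh
    have : s * (u * L.xfun (X - C P.x) + v * (L.yfun - L.xfun (C P.y))) =
        u * (s * L.xfun (X - C P.x)) + v * (s * (L.yfun - L.xfun (C P.y))) := by ring
    rw [this]
    exact add_mem (Ideal.mul_mem_left _ _ h1) (Ideal.mul_mem_left _ _ h2)
  by_cases hy : P.y = 0
  · have h0 : L.poly.eval P.x = 0 := by rw [← P.eqn, hy]; ring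
    obtain ⟨k, hk, hk0⟩ := hL.exists_eq_mul h0
    refine ⟨L.yfun, by simp [mem_ideal_iff, hy], L.xfun k, by simp [mem_ideal_iff, hk0],
      key _ _ ?_ ?_⟩
    · rw [← map_mul, mul_comm, ← hk, ← yfun_sq, Ideal.mem_span_singleton]
      exact dvd_pow_self _ two_ne_zero
    · simp only [hy, map_zero, sub_zero]
      exact Ideal.mul_mem_left _ _ (Ideal.mem_span_singleton_self _)
  · refine ⟨L.xfun (X - C P.x), by simp [mem_ideal_iff], L.yfun + L.xfun (C P.y), ?_,
      key _ _ (Ideal.mul_mem_left _ _ (Ideal.mem_span_singleton_self _)) ?_⟩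
    · simp [mem_ideal_iff, ← two_mul, hy]
    · obtain ⟨k, hk⟩ := X_sub_C_dvd_sub_C_eval (a := P.x) (p := L.poly)
      have : (L.yfun + L.xfun (C P.y)) * (L.yfun - L.xfun (C P.y)) =
          L.xfun (X - C P.x) * L.xfun k := by
        rw [← map_mul, ← hk, ← P.eqn, map_sub, ← yfun_sq, C_pow, map_pow]
        ring
      rw [this]
      exact Ideal.mul_mem_right _ _ (Ideal.mem_span_singleton_self _)

theorem Nondegenerate.isDedekindDomain (hL : L.Nondegenerate) : IsDedekindDomain L.CoordRing := by
  have hN : IsNoetherianRing L.CoordRing :=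
    isNoetherianRing_of_surjective _ _ (AdjoinRoot.mk (X ^ 2 - C L.poly : ℂ[X][X]))
      AdjoinRoot.mk_surjective
  have : IsDedekindDomainDvr L.CoordRing :=
    { is_dvr_at_nonzero_prime := fun I h0 hI => by
        obtain ⟨P, rfl⟩ := exists_eq_ideal hI h0
        have hnf := IsLocalization.AtPrime.not_isField L.CoordRing h0
          (Localization.AtPrime P.ideal)
        have hN' : IsNoetherianRing (Localization.AtPrime P.ideal) :=
          IsLocalization.isNoetherianRing P.ideal.primeCompl _ hN
        -- Item 4 of the list says that the maximal ideal is principal. The function `s` becomes a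
        -- unit in the localization, so the image of `p` generates.
        refine ((IsDiscreteValuationRing.TFAE (Localization.AtPrime P.ideal) hnf).out 0 4).2 ?_
        obtain ⟨p, hp, s, hs, h⟩ := P.exists_uniformizer hL
        refine ⟨algebraMap _ _ p, ?_⟩
        rw [← Localization.AtPrime.map_eq_maximalIdeal, Ideal.submodule_span_eq]
        apply le_antisymm
        · rw [Ideal.map_le_iff_le_comap]
          intro g hg
          rw [Ideal.mem_comap]
          have h1 := Ideal.mem_map_of_mem (algebraMap _ (Localization.AtPrime P.ideal)) (h g hg)
          rw [Ideal.map_span, Set.image_singleton, map_mul] at h1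
          exact (Ideal.unit_mul_mem_iff_mem _
            (IsLocalization.map_units (Localization.AtPrime P.ideal)
              (⟨s, hs⟩ : P.ideal.primeCompl))).1 h1
        · rw [Ideal.span_singleton_le_iff_mem]
          exact Ideal.mem_map_of_mem _ hp }
  infer_instance

open scoped Pointwise in
-- The hard inclusion is that `x - x_P` lies in the product. If `y_P ≠ 0`, then `2 y_P (x - x_P)` is
-- a difference of two generators of the product. If `y_P = 0`, write `y² = (x - x_P) l`; replacing
-- `l` by its nonzero value at `x_P` costs only a multiple of `(x - x_P)²`.
theorem AffinePoint.ideal_mul_invol (hL : L.Nondegenerate) (P : L.AffinePoint) :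
    P.ideal * P.invol.ideal = Ideal.span {L.xfun (X - C P.x)} := by
  rw [ideal_eq, ideal_eq, Ideal.span_mul_span']
  obtain ⟨k, hk⟩ := X_sub_C_dvd_sub_C_eval (a := P.x) (p := L.poly)
  have hm : (L.yfun + L.xfun (C P.y)) * (L.yfun - L.xfun (C P.y)) =
      L.xfun (X - C P.x) * L.xfun k := by
    rw [← map_mul, ← hk, ← P.eqn, map_sub, ← yfun_sq, C_pow, map_pow]
    ring
  apply le_antisymm
  · rw [Ideal.span_le]
    rintro _ ⟨g, (rfl | rfl), h, (rfl | rfl), rfl⟩ <;>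
      rw [SetLike.mem_coe, Ideal.mem_span_singleton]
    · exact dvd_mul_right _ _
    · exact dvd_mul_right _ _
    · exact dvd_mul_left _ _
    · refine ⟨L.xfun k, ?_⟩
      simp only [invol_y, map_neg]
      linear_combination hm
  · rw [Ideal.span_singleton_le_iff_mem]
    set I := Ideal.span (({L.xfun (X - C P.x), L.yfun - L.xfun (C P.y)} : Set L.CoordRing) *
      ({L.xfun (X - C P.invol.x), L.yfun - L.xfun (C P.invol.y)} : Set L.CoordRing))
    have h11 : L.xfun (X - C P.x) * L.xfun (X - C P.x) ∈ I :=
      Ideal.subset_span (Set.mul_mem_mul (by simp) (by simp))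
    have h12 : L.xfun (X - C P.x) * (L.yfun - L.xfun (C P.invol.y)) ∈ I :=
      Ideal.subset_span (Set.mul_mem_mul (by simp) (by simp))
    have h21 : (L.yfun - L.xfun (C P.y)) * L.xfun (X - C P.x) ∈ I :=
      Ideal.subset_span (Set.mul_mem_mul (by simp) (by simp))
    have h22 : (L.yfun - L.xfun (C P.y)) * (L.yfun - L.xfun (C P.invol.y)) ∈ I :=
      Ideal.subset_span (Set.mul_mem_mul (by simp) (by simp))
    have unit : ∀ c : ℂ, c ≠ 0 → L.xfun (C c) * L.xfun (X - C P.x) ∈ I →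
        L.xfun (X - C P.x) ∈ I := fun c hc h =>
      (Ideal.unit_mul_mem_iff_mem _ (IsUnit.map _ (isUnit_C.2 (isUnit_iff_ne_zero.2 hc)))).1 h
    by_cases hy : P.y = 0
    · have h0 : L.poly.eval P.x = 0 := by rw [← P.eqn, hy]; ring
      obtain ⟨l, hl, hl0⟩ := hL.exists_eq_mul h0
      obtain ⟨m, hm⟩ := X_sub_C_dvd_sub_C_eval (a := P.x) (p := l)
      refine unit _ hl0 ?_
      have : L.xfun (C (l.eval P.x)) * L.xfun (X - C P.x) =
          (L.yfun - L.xfun (C P.y)) * (L.yfun - L.xfun (C P.invol.y)) -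
          L.xfun m * (L.xfun (X - C P.x) * L.xfun (X - C P.x)) := by
        have e1 : L.yfun * L.yfun = L.xfun (X - C P.x) * L.xfun l := by
          rw [← sq, yfun_sq, ← map_mul, ← hl]
        have e2 := congrArg L.xfun hm
        rw [map_sub, map_mul] at e2
        simp only [invol_y, hy, neg_zero, map_zero, sub_zero]
        linear_combination -e1 - L.xfun (X - C P.x) * e2
      rw [this]
      exact sub_mem h22 (Ideal.mul_mem_left _ _ h11)
    · refine unit (2 * P.y) (mul_ne_zero two_ne_zero hy) ?_
      have : L.xfun (C (2 * P.y)) * L.xfun (X - C P.x) =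
          L.xfun (X - C P.x) * (L.yfun - L.xfun (C P.invol.y)) -
            (L.yfun - L.xfun (C P.y)) * L.xfun (X - C P.x) := by
        simp only [invol_y, map_neg, map_mul, map_ofNat]
        ring
      rw [this]
      exact sub_mem h12 h21

instance [hL : Fact L.Nondegenerate] : IsDedekindDomain L.CoordRing := hL.out.isDedekindDomain

/-! ### Products of ideals of points -/

/-- The ideal of the functions vanishing on an effective affine divisor. -/
def idealProd (s : Multiset L.AffinePoint) : Ideal L.CoordRing :=
  (s.map AffinePoint.ideal).prod

@[simp] theorem idealProd_zero : idealProd (0 : Multiset L.AffinePoint) = 1 := by simp [idealProd]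

@[simp] theorem idealProd_cons (P : L.AffinePoint) (s : Multiset L.AffinePoint) :
    idealProd (P ::ₘ s) = P.ideal * idealProd s := by simp [idealProd]

theorem idealProd_add (s t : Multiset L.AffinePoint) :
    idealProd (s + t) = idealProd s * idealProd t := by simp [idealProd]

theorem idealProd_replicate (n : ℕ) (P : L.AffinePoint) :
    idealProd (Multiset.replicate n P) = P.ideal ^ n := by simp [idealProd]

/-- The involution on functions, `y ↦ -y`. -/
def conj (L : Genus2) : L.CoordRing →+* L.CoordRing :=
  AdjoinRoot.lift L.xfun (-L.yfun) (by simp [eval₂_sub, yfun_sq])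

@[simp] theorem conj_func (a b : ℂ[X]) : L.conj (L.func a b) = L.func a (-b) := by
  simp [conj, func_def]

theorem conj_comp_conj : L.conj.comp L.conj = RingHom.id _ := by
  ext h
  all_goals simp [conj]

theorem map_conj_ideal_le (P : L.AffinePoint) : P.ideal.map L.conj ≤ P.invol.ideal := by
  rw [Ideal.map_le_iff_le_comap]
  intro h hh
  obtain ⟨a, b, rfl⟩ := exists_func h
  rw [AffinePoint.mem_ideal_iff, AffinePoint.eval_func] at hh
  rw [Ideal.mem_comap, conj_func, AffinePoint.mem_ideal_iff, AffinePoint.eval_func]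
  simpa using hh

theorem map_conj_ideal (P : L.AffinePoint) : P.ideal.map L.conj = P.invol.ideal := by
  refine le_antisymm (map_conj_ideal_le P) ?_
  calc P.invol.ideal = (P.invol.ideal.map L.conj).map L.conj := by
        rw [Ideal.map_map, conj_comp_conj, Ideal.map_id]
    _ ≤ P.ideal.map L.conj := Ideal.map_mono (by simpa using map_conj_ideal_le P.invol)

theorem map_conj_idealProd (s : Multiset L.AffinePoint) :
    (idealProd s).map L.conj = idealProd (s.map AffinePoint.invol) := by
  induction s using Multiset.induction_on with
  | empty => simp [Ideal.one_eq_top, Ideal.map_top]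
  | cons P s ih => rw [idealProd_cons, Ideal.map_mul, ih, map_conj_ideal]; simp

theorem xfun_dvd_iff {p q : ℂ[X]} : L.xfun p ∣ L.xfun q ↔ p ∣ q := by
  refine ⟨fun ⟨h, hh⟩ => ?_, map_dvd _⟩
  obtain ⟨c, d, rfl⟩ := exists_func h
  rw [← func_zero_right, ← func_zero_right, func_mul] at hh
  exact ⟨c, by simpa using (func_injective hh).1⟩

section Dedekind

variable [hL : Fact L.Nondegenerate]

theorem prime_of_mem {s : Multiset L.AffinePoint} :
    ∀ I ∈ s.map AffinePoint.ideal, Prime I := by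
  intro I hI
  obtain ⟨P, -, rfl⟩ := Multiset.mem_map.1 hI
  exact Ideal.prime_of_isPrime P.ideal_ne_bot P.ideal_isMaximal.isPrime

theorem idealProd_ne_bot (s : Multiset L.AffinePoint) : idealProd s ≠ ⊥ := by
  rw [idealProd, ← Ideal.zero_eq_bot, Ne, Multiset.prod_eq_zero_iff]
  intro h
  exact (prime_of_mem _ h).ne_zero rfl

theorem normalizedFactors_idealProd (s : Multiset L.AffinePoint) :
    UniqueFactorizationMonoid.normalizedFactors (idealProd s) = s.map AffinePoint.ideal :=
  UniqueFactorizationMonoid.normalizedFactors_prod_of_prime prime_of_mem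

theorem idealProd_injective :
    Function.Injective (idealProd : Multiset L.AffinePoint → Ideal L.CoordRing) := by
  intro s t h
  refine Multiset.map_injective AffinePoint.ideal_injective ?_
  rw [← normalizedFactors_idealProd, h, normalizedFactors_idealProd]

theorem idealProd_le_iff {s t : Multiset L.AffinePoint} :
    idealProd t ≤ idealProd s ↔ s ≤ t := by
  rw [← Ideal.dvd_iff_le, UniqueFactorizationMonoid.dvd_iff_normalizedFactors_le_normalizedFactors
    (idealProd_ne_bot s) (idealProd_ne_bot t), normalizedFactors_idealProd,
    normalizedFactors_idealProd, Multiset.map_le_map_iff AffinePoint.ideal_injective]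

theorem exists_eq_idealProd {I : Ideal L.CoordRing} (hI : I ≠ ⊥) : ∃ s, I = idealProd s := by
  have : Nonempty L.AffinePoint := ⟨(AffinePoint.exists_x_eq L 0).choose⟩
  have h : ∀ J ∈ UniqueFactorizationMonoid.normalizedFactors I, ∃ P : L.AffinePoint,
      P.ideal = J := by
    intro J hJ
    have hp := UniqueFactorizationMonoid.prime_of_normalized_factor J hJ
    obtain ⟨P, hP⟩ := exists_eq_ideal (Ideal.isPrime_of_prime hp) hp.ne_zero
    exact ⟨P, hP.symm⟩
  choose! g hg using h
  refine ⟨(UniqueFactorizationMonoid.normalizedFactors I).map g, ?_⟩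
  rw [idealProd, Multiset.map_map,
    Multiset.map_congr (f := AffinePoint.ideal ∘ g) (g := id) rfl hg, Multiset.map_id,
    Ideal.prod_normalizedFactors_eq_self hI]

theorem idealProd_le_pow_iff [DecidableEq L.AffinePoint] {s : Multiset L.AffinePoint}
    {P : L.AffinePoint} {n : ℕ} : idealProd s ≤ P.ideal ^ n ↔ n ≤ s.count P := by
  rw [← idealProd_replicate, idealProd_le_iff, Multiset.le_count_iff_replicate_le]

theorem idealProd_add_invol (s : Multiset L.AffinePoint) :
    idealProd (s + s.map AffinePoint.invol) =
      Ideal.span {L.xfun (s.map fun P => X - C P.x).prod} := by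
  induction s using Multiset.induction_on with
  | empty => simp
  | cons P s ih =>
    rw [Multiset.map_cons, Multiset.map_cons, Multiset.prod_cons, map_mul,
      ← Ideal.span_singleton_mul_span_singleton, ← ih, ← P.ideal_mul_invol hL.out,
      idealProd_add, idealProd_add, idealProd_cons, idealProd_cons]
    ring

/-- The norm of a function is determined by its zeros. -/
theorem associated_normPoly {a b : ℂ[X]} {s : Multiset L.AffinePoint}
    (h : Ideal.span {L.func a b} = idealProd s) :
    Associated (L.normPoly a b) (s.map fun P => X - C P.x).prod := by
  have h1 : Ideal.span {L.func a (-b)} = idealProd (s.map AffinePoint.invol) := by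
    rw [← map_conj_idealProd, ← h, Ideal.map_span, Set.image_singleton, conj_func]
  have h2 := idealProd_add_invol s
  rw [idealProd_add, ← h, ← h1, Ideal.span_singleton_mul_span_singleton, func_mul_conj] at h2
  refine associated_of_dvd_dvd ?_ ?_ <;> rw [← xfun_dvd_iff (L := L)]
  · rw [← Ideal.span_singleton_le_span_singleton, h2]
  · rw [← Ideal.span_singleton_le_span_singleton, h2]

/-- Zeros and poles balance: both sides are the degree of the norm. -/
theorem weight_eq_card {a b : ℂ[X]} {s : Multiset L.AffinePoint}
    (h : Ideal.span {L.func a b} = idealProd s) : weight a b = Multiset.card s := by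
  rw [← natDegree_normPoly (L := L), natDegree_eq_of_degree_eq
    (degree_eq_degree_of_associated (associated_normPoly h)),
    natDegree_multiset_prod_of_monic _ (by simp +contextual [monic_X_sub_C])]
  simp

end Dedekind

/-- The generator is `g / h`. This replaces a rational function without finite poles by a polynomial
function. -/
theorem exists_span_singleton_eq {R : Type*} [CommRing R] [IsDomain R] {I : Ideal R} {g h : R}
    (h0 : h ≠ 0) (hg : Ideal.span {g} = I * Ideal.span {h}) : ∃ k, Ideal.span {k} = I := by
  have h1 : h ∣ g := by
    rw [← Ideal.span_singleton_le_span_singleton, hg]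
    exact Ideal.mul_le_right
  obtain ⟨k, rfl⟩ := h1
  refine ⟨k, (Ideal.span_singleton_mul_right_inj h0).1 ?_⟩
  rw [Ideal.span_singleton_mul_span_singleton, hg]
  exact mul_comm _ _

/-! ### Divisors and the Jacobian -/

/-- The effective affine divisor with the given points. -/
def pointSum (s : Multiset L.AffinePoint) : L.Divisor :=
  (s.map fun P => Finsupp.single (Point.affine P) (1 : ℤ)).sum

@[simp] theorem pointSum_zero : pointSum (0 : Multiset L.AffinePoint) = 0 := by simp [pointSum]

@[simp] theorem pointSum_cons (P : L.AffinePoint) (s : Multiset L.AffinePoint) :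
    pointSum (P ::ₘ s) = Finsupp.single (Point.affine P) 1 + pointSum s := by simp [pointSum]

theorem pointSum_add (s t : Multiset L.AffinePoint) :
    pointSum (s + t) = pointSum s + pointSum t := by simp [pointSum]

theorem pointSum_affine [DecidableEq L.AffinePoint] (s : Multiset L.AffinePoint)
    (P : L.AffinePoint) : pointSum s (Point.affine P) = s.count P := by
  classical
  induction s using Multiset.induction_on with
  | empty => simp
  | cons Q s ih =>
    rw [pointSum_cons, Finsupp.add_apply, ih, Multiset.count_cons, Finsupp.single_apply]
    by_cases h : P = Q
    · subst h; simp [add_comm]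
    · simp [h, Ne.symm h]

theorem pointSum_infinity (s : Multiset L.AffinePoint) : pointSum s Point.infinity = 0 := by
  induction s using Multiset.induction_on with
  | empty => simp
  | cons Q s ih => simp [ih]

@[simp] theorem degree_single (P : L.Point) (n : ℤ) : L.degree (Finsupp.single P n) = n :=
  Finsupp.liftAddHom_apply_single _ _ _

theorem degree_pointSum (s : Multiset L.AffinePoint) :
    L.degree (pointSum s) = Multiset.card s := by
  induction s using Multiset.induction_on with
  | empty => simp
  | cons Q s ih => simp [ih, add_comm]

/-- The divisor of degree zero `∑ (P - ∞)`. -/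
def degZero (s : Multiset L.AffinePoint) : L.Divisor :=
  pointSum s - Finsupp.single Point.infinity (Multiset.card s : ℤ)

theorem degZero_add (s t : Multiset L.AffinePoint) :
    degZero (s + t) = degZero s + degZero t := by
  rw [degZero, degZero, degZero, pointSum_add, Multiset.card_add, Nat.cast_add,
    Finsupp.single_add]
  abel

theorem degZero_injective : Function.Injective (degZero (L := L)) := by
  classical
  intro s t h
  ext P
  have h1 := DFunLike.congr_fun h (Point.affine P)
  simpa [degZero, pointSum_affine] using h1

/-- The class map is additive. -/
def jacHom (L : Genus2) : L.Divisor →+ L.Jac where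
  toFun := jacClass
  map_zero' := by
    rw [jacClass, QuotientAddGroup.eq_zero_iff, AddSubgroup.mem_addSubgroupOf]
    simp
  map_add' D E := by
    rw [jacClass, jacClass, jacClass, ← QuotientAddGroup.mk_add]
    congr 1
    ext1
    simp only [map_add, AddSubgroup.coe_add, Finsupp.single_add]
    abel

theorem jacHom_apply (D : L.Divisor) : L.jacHom D = jacClass D := rfl

theorem jacClass_eq_zero_iff {D : L.Divisor} :
    jacClass D = 0 ↔ D - Finsupp.single Point.infinity (L.degree D) ∈ L.principal := by
  rw [jacClass, QuotientAddGroup.eq_zero_iff, AddSubgroup.mem_addSubgroupOf]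

theorem jacHom_surjective (L : Genus2) : Function.Surjective L.jacHom := by
  intro c
  obtain ⟨⟨D, hD⟩, rfl⟩ := QuotientAddGroup.mk_surjective c
  refine ⟨D, ?_⟩
  rw [jacHom_apply, jacClass]
  congr 1
  ext1
  simp [AddMonoidHom.mem_ker.1 hD]

theorem jacHom_infinity (n : ℤ) : L.jacHom (Finsupp.single Point.infinity n) = 0 := by
  rw [jacHom_apply, jacClass_eq_zero_iff]
  simp

/-- The point `[P - ∞]` of the Jacobian. -/
def AffinePoint.cls (P : L.AffinePoint) : L.Jac :=
  L.jacHom (Finsupp.single (Point.affine P) 1)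

theorem jacHom_pointSum (s : Multiset L.AffinePoint) :
    L.jacHom (pointSum s) = (s.map AffinePoint.cls).sum := by
  induction s using Multiset.induction_on with
  | empty => simp
  | cons Q s ih => simp [ih, AffinePoint.cls]

theorem jacClass_pair (P Q : L.AffinePoint) : jacClass (pair P Q) = P.cls + Q.cls := by
  rw [← jacHom_apply, pair, map_add]; rfl

theorem jacClass_add_infinity (P : L.AffinePoint) :
    jacClass (Finsupp.single (Point.affine P) 1 + Finsupp.single Point.infinity 1) = P.cls := by
  rw [← jacHom_apply, map_add, jacHom_infinity, add_zero]; rfl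

theorem isSpecial_iff {c : L.Jac} : IsSpecial c ↔ ∃ P : L.AffinePoint, c = P.cls := by
  simp only [IsSpecial, jacClass_add_infinity]

theorem isNonSpecial_iff {c : L.Jac} :
    IsNonSpecial c ↔ ∃ P Q : L.AffinePoint, Q ≠ P.invol ∧ c = P.cls + Q.cls := by
  constructor
  · rintro ⟨_, ⟨P, Q, h, rfl⟩, rfl⟩
    exact ⟨P, Q, h, jacClass_pair P Q⟩
  · rintro ⟨P, Q, h, rfl⟩
    exact ⟨_, ⟨P, Q, h, rfl⟩, (jacClass_pair P Q).symm⟩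

section Dedekind

variable [hL : Fact L.Nondegenerate]

theorem isDivisorOf_degZero {a b : ℂ[X]} {s : Multiset L.AffinePoint}
    (h : Ideal.span {L.func a b} = idealProd s) : IsDivisorOf (degZero s) a b := by
  classical
  refine ⟨fun P => ⟨s.count P, ?_, ?_, ?_⟩, ?_⟩
  · simp [degZero, pointSum_affine]
  · rw [← Ideal.span_singleton_le_iff_mem, h, idealProd_le_pow_iff]
  · rw [← Ideal.span_singleton_le_iff_mem, h, idealProd_le_pow_iff]
    omega
  · simp [degZero, pointSum_infinity, weight_eq_card h]

theorem IsDivisorOf.eq_degZero {a b : ℂ[X]} {s : Multiset L.AffinePoint} {D : L.Divisor}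
    (hD : IsDivisorOf D a b) (h : Ideal.span {L.func a b} = idealProd s) : D = degZero s := by
  classical
  ext P
  cases P with
  | infinity => rw [hD.2]; simp [degZero, pointSum_infinity, weight_eq_card h]
  | affine P =>
    obtain ⟨n, h1, h2, h3⟩ := hD.1 P
    rw [← Ideal.span_singleton_le_iff_mem, h, idealProd_le_pow_iff] at h2 h3
    rw [h1]
    simp only [degZero, Finsupp.sub_apply, pointSum_affine]
    simp
    omega

/-- Products and inverses of quotients are quotients, so the generated subgroup contains nothing but
divisors of `g / h`. -/
theorem exists_of_mem_principal {D : L.Divisor} (hD : D ∈ L.principal) :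
    ∃ s t : Multiset L.AffinePoint, ∃ g h : L.CoordRing, Ideal.span {g} = idealProd s ∧
      Ideal.span {h} = idealProd t ∧ D = degZero s - degZero t := by
  induction hD using AddSubgroup.closure_induction with
  | mem D hD =>
    obtain ⟨a, b, h0, hD⟩ := hD
    obtain ⟨s, hs⟩ := exists_eq_idealProd (L := L) (I := Ideal.span {L.func a b})
      (by rwa [Ne, Ideal.span_singleton_eq_bot, func_eq_zero_iff])
    exact ⟨s, 0, _, 1, hs, by simp, by simpa [degZero] using hD.eq_degZero hs⟩
  | zero => exact ⟨0, 0, 1, 1, by simp, by simp, by simp⟩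
  | add D E _ _ hD hE =>
    obtain ⟨s, t, g, h, hg, hh, rfl⟩ := hD
    obtain ⟨s', t', g', h', hg', hh', rfl⟩ := hE
    refine ⟨s + s', t + t', g * g', h * h', ?_, ?_, ?_⟩
    · rw [← Ideal.span_singleton_mul_span_singleton, hg, hg', idealProd_add]
    · rw [← Ideal.span_singleton_mul_span_singleton, hh, hh', idealProd_add]
    · rw [degZero_add, degZero_add]; abel
  | neg D _ hD =>
    obtain ⟨s, t, g, h, hg, hh, rfl⟩ := hD
    exact ⟨t, s, h, g, hh, hg, by abel⟩

/-- An effective affine divisor has trivial class if and only if its ideal is principal. -/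
theorem sum_cls_eq_zero_iff {s : Multiset L.AffinePoint} :
    (s.map AffinePoint.cls).sum = 0 ↔ ∃ h : L.CoordRing, Ideal.span {h} = idealProd s := by
  rw [← jacHom_pointSum, jacHom_apply, jacClass_eq_zero_iff, degree_pointSum]
  change degZero s ∈ L.principal ↔ _
  constructor
  · intro hs
    obtain ⟨t, u, g, h, hg, hh, e⟩ := exists_of_mem_principal hs
    -- Here `t = s + u` as multisets, so `(g)` is the ideal of `s` times `(h)`, and the principal
    -- factor can be cancelled.
    rw [eq_sub_iff_add_eq, ← degZero_add] at e
    have e := degZero_injective e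
    subst e
    have h0 : h ≠ 0 := by
      rintro rfl
      exact idealProd_ne_bot u (by rw [← hh]; simp)
    rw [idealProd_add, ← hh] at hg
    exact exists_span_singleton_eq h0 hg
  · rintro ⟨h, hh⟩
    obtain ⟨a, b, rfl⟩ := exists_func h
    refine AddSubgroup.subset_closure ⟨a, b, ?_, isDivisorOf_degZero hh⟩
    rw [← func_eq_zero_iff (L := L)]
    intro h0
    exact idealProd_ne_bot s (by rw [← hh, h0]; simp)

theorem AffinePoint.cls_add_cls_invol (P : L.AffinePoint) : P.cls + P.invol.cls = 0 := by
  have h := (sum_cls_eq_zero_iff (s := P ::ₘ {P.invol})).2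
    ⟨L.xfun (X - C P.x), by simp [idealProd, P.ideal_mul_invol hL.out]⟩
  simpa using h

theorem AffinePoint.cls_invol (P : L.AffinePoint) : P.invol.cls = -P.cls :=
  (neg_eq_of_add_eq_zero_right P.cls_add_cls_invol).symm

end Dedekind

/-! ### Reduced divisors -/

theorem smul_eq_xfun_mul (c : ℂ) (h : L.CoordRing) : c • h = L.xfun (C c) * h := by
  rw [Algebra.smul_def]
  rfl

section Dedekind

variable [hL : Fact L.Nondegenerate]

/-- Each root `c` of `a` contributes a point over `c` and its image under the involution; which of
the two is chosen is irrelevant. -/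
theorem exists_span_xfun_eq {a : ℂ[X]} (ha : a ≠ 0) : ∃ t : Multiset L.AffinePoint,
    Ideal.span {L.xfun a} = idealProd (t + t.map AffinePoint.invol) := by
  choose g hg using AffinePoint.exists_x_eq L
  refine ⟨a.roots.map g, ?_⟩
  rw [idealProd_add_invol, Multiset.map_map]
  have h1 : ((fun P : L.AffinePoint => X - C P.x) ∘ g) = fun c => X - C c := by
    funext c; simp [hg]
  rw [h1]
  conv_lhs => rw [(IsAlgClosed.splits a).eq_prod_roots, map_mul]
  exact Ideal.span_singleton_mul_left_unit
    (IsUnit.map _ (isUnit_C.2 (isUnit_iff_ne_zero.2 (leadingCoeff_ne_zero.2 ha)))) _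

/-- At most four points with trivial sum are exchanged in pairs by the involution. -/
theorem invol_mem_of_sum_cls_eq_zero {P : L.AffinePoint} {s : Multiset L.AffinePoint}
    (hs : Multiset.card s ≤ 3) (h : P.cls + (s.map AffinePoint.cls).sum = 0) : P.invol ∈ s := by
  classical
  rw [← Multiset.sum_cons, ← Multiset.map_cons, sum_cls_eq_zero_iff] at h
  obtain ⟨f, hf⟩ := h
  obtain ⟨a, b, rfl⟩ := exists_func f
  have hw := weight_eq_card hf
  rw [Multiset.card_cons] at hw
  -- The weight is the number of zeros, at most 4, whereas a term in `y` would make it at least 5.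
  have hb : b = 0 := by
    by_contra hb
    rw [weight, if_neg hb] at hw
    omega
  subst hb
  have ha : a ≠ 0 := by
    rintro rfl
    exact idealProd_ne_bot (P ::ₘ s) (by rw [← hf]; simp [func_def])
  obtain ⟨t, ht⟩ := exists_span_xfun_eq (L := L) ha
  rw [func_zero_right, ht] at hf
  have e := idealProd_injective hf
  have key : ∀ A : L.AffinePoint, A ∈ t → (P = A ∨ P = A.invol) → P.invol ∈ s := by
    intro A hA hPA
    obtain ⟨u, rfl⟩ := Multiset.exists_cons_of_mem hA
    rw [Multiset.map_cons, Multiset.cons_add, Multiset.add_cons] at e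
    rcases hPA with rfl | rfl
    · rw [Multiset.cons_inj_right] at e
      rw [← e]; simp
    · rw [Multiset.cons_swap, Multiset.cons_inj_right] at e
      rw [← e]; simp
  have hP : P ∈ t + t.map AffinePoint.invol := by rw [e]; simp
  rcases Multiset.mem_add.1 hP with hP | hP
  · exact key P hP (Or.inl rfl)
  · obtain ⟨A, hA, rfl⟩ := Multiset.mem_map.1 hP
    exact key A hA (Or.inr rfl)

namespace AffinePoint

theorem cls_ne_zero (P : L.AffinePoint) : P.cls ≠ 0 := fun h => by
  simpa using invol_mem_of_sum_cls_eq_zero (P := P) (s := 0) (by simp) (by simpa using h)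

theorem cls_add_cls_eq_zero_iff {P Q : L.AffinePoint} : P.cls + Q.cls = 0 ↔ Q = P.invol := by
  refine ⟨fun h => ?_, fun h => by rw [h, cls_add_cls_invol]⟩
  have := invol_mem_of_sum_cls_eq_zero (P := P) (s := {Q}) (by simp) (by simpa using h)
  exact (Multiset.mem_singleton.1 this).symm

theorem cls_injective : Function.Injective (cls (L := L)) := by
  intro P Q h
  have h1 : P.cls + Q.invol.cls = 0 := by rw [cls_invol, h, add_neg_cancel]
  rw [cls_add_cls_eq_zero_iff] at h1
  rw [← invol_invol P, ← h1, invol_invol]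

/-- Otherwise `P`, `Q` and the conjugate of `R` have trivial sum. Two of them cancel, leaving a
single point with trivial class. -/
theorem cls_add_cls_ne_cls (P Q R : L.AffinePoint) : P.cls + Q.cls ≠ R.cls := by
  intro h
  have := invol_mem_of_sum_cls_eq_zero (P := P) (s := {Q, R.invol}) (by simp)
    (by simp [cls_invol, ← h])
  rw [Multiset.insert_eq_cons, Multiset.mem_cons, Multiset.mem_singleton] at this
  rcases this with h1 | h1
  · rw [← h1, cls_add_cls_invol] at h
    exact R.cls_ne_zero h.symm
  · have h2 : P = R := by rw [← invol_invol P, h1, invol_invol]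
    rw [h2, add_eq_left] at h
    exact Q.cls_ne_zero h

/-- Apply the cancellation in pairs to `P`, `Q` and the conjugates of `R`, `S`: since `Q` is not
conjugate to `P`, the partner of `P` comes from `R` or `S`. -/
theorem cls_add_cls_eq_iff {P Q R S : L.AffinePoint} (hPQ : Q ≠ P.invol) :
    P.cls + Q.cls = R.cls + S.cls ↔ P = R ∧ Q = S ∨ P = S ∧ Q = R := by
  constructor
  · intro h
    have := invol_mem_of_sum_cls_eq_zero (P := P) (s := {Q, R.invol, S.invol}) (by simp)
      (by simp [cls_invol]; rw [← add_assoc, h]; abel)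
    simp only [Multiset.insert_eq_cons, Multiset.mem_cons, Multiset.mem_singleton] at this
    rcases this with h1 | h1 | h1
    · exact absurd h1.symm hPQ
    · have h2 : P = R := by rw [← invol_invol P, h1, invol_invol]
      rw [h2, add_right_inj] at h
      exact Or.inl ⟨h2, cls_injective h⟩
    · have h2 : P = S := by rw [← invol_invol P, h1, invol_invol]
      rw [h2, add_comm, add_left_inj] at h
      exact Or.inr ⟨h2, cls_injective h⟩
  · rintro (⟨rfl, rfl⟩ | ⟨rfl, rfl⟩)
    · rfl
    · exact add_comm _ _

theorem two_nsmul_cls_eq_zero_iff {P : L.AffinePoint} : 2 • P.cls = 0 ↔ P.y = 0 := by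
  rw [two_nsmul, cls_add_cls_eq_zero_iff, eq_comm, invol_eq_self_iff]

/-- A non-special class is killed by `2` exactly when both points are branch points. -/
theorem two_nsmul_cls_add_cls_eq_zero_iff {P Q : L.AffinePoint} (hPQ : Q ≠ P.invol) :
    2 • (P.cls + Q.cls) = 0 ↔ P.y = 0 ∧ Q.y = 0 := by
  constructor
  · intro h
    rw [two_nsmul, ← eq_neg_iff_add_eq_zero, neg_add, ← cls_invol, ← cls_invol,
      cls_add_cls_eq_iff hPQ] at h
    rcases h with ⟨h1, h2⟩ | ⟨h1, h2⟩
    · exact ⟨(invol_eq_self_iff P).1 h1.symm, (invol_eq_self_iff Q).1 h2.symm⟩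
    · exact absurd h2 hPQ
  · rintro ⟨h1, h2⟩
    rw [nsmul_add, two_nsmul_cls_eq_zero_iff.2 h1, two_nsmul_cls_eq_zero_iff.2 h2, add_zero]

end AffinePoint

/-! ### Disjointness of the kinds of classes, and uniqueness of non-special divisors. -/

theorem IsSpecial.ne_zero {c : L.Jac} (h : IsSpecial c) : c ≠ 0 := by
  obtain ⟨P, rfl⟩ := isSpecial_iff.1 h
  exact P.cls_ne_zero

theorem IsNonSpecial.ne_zero {c : L.Jac} (h : IsNonSpecial c) : c ≠ 0 := by
  obtain ⟨P, Q, h, rfl⟩ := isNonSpecial_iff.1 h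
  rwa [Ne, AffinePoint.cls_add_cls_eq_zero_iff]

theorem IsNonSpecial.not_isSpecial {c : L.Jac} (h : IsNonSpecial c) : ¬ IsSpecial c := by
  obtain ⟨P, Q, h, rfl⟩ := isNonSpecial_iff.1 h
  rw [isSpecial_iff]
  rintro ⟨R, hR⟩
  exact P.cls_add_cls_ne_cls Q R hR

theorem IsNonSpecialDivisor.eq_of_jacClass_eq {D E : L.Divisor} (hD : IsNonSpecialDivisor D)
    (hE : IsNonSpecialDivisor E) (h : jacClass D = jacClass E) : D = E := by
  obtain ⟨P, Q, hPQ, rfl⟩ := hD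
  obtain ⟨R, S, -, rfl⟩ := hE
  rw [jacClass_pair, jacClass_pair, AffinePoint.cls_add_cls_eq_iff hPQ] at h
  rcases h with ⟨rfl, rfl⟩ | ⟨rfl, rfl⟩
  · rfl
  · exact add_comm _ _

/-- The quotient of `I` by `I * P.ideal` is a line over `ℂ`: no ideal lies strictly between the two,
so `f` generates it, and a coefficient acts there through its value at `P`. -/
theorem exists_sub_smul_mem {I : Ideal L.CoordRing} (hI : I ≠ ⊥) (P : L.AffinePoint)
    {f g : L.CoordRing} (hf : f ∈ I) (hf' : f ∉ I * P.ideal) (hg : g ∈ I) :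
    ∃ z : ℂ, g - z • f ∈ I * P.ideal := by
  have h1 : Ideal.span {f} ⊔ I * P.ideal ≤ I :=
    sup_le ((Ideal.span_singleton_le_iff_mem _).2 hf) Ideal.mul_le_left
  obtain ⟨M, hM⟩ := Ideal.dvd_iff_le.2 h1
  have h2 : P.ideal ≤ M := by
    rw [← Ideal.dvd_iff_le]
    refine (mul_dvd_mul_iff_left (a := I) hI).1 ?_
    rw [← hM, Ideal.dvd_iff_le]
    exact le_sup_right
  have h3 : M = ⊤ := by
    by_contra h
    refine hf' ?_
    rw [P.ideal_isMaximal.eq_of_le h h2, ← hM]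
    exact Ideal.mem_sup_left (Ideal.mem_span_singleton_self f)
  rw [h3, Ideal.mul_top] at hM
  rw [← hM, Ideal.mem_span_singleton_sup] at hg
  obtain ⟨d, e, he, rfl⟩ := hg
  refine ⟨P.eval d, ?_⟩
  have h4 : d * f + e - P.eval d • f = f * (d - L.xfun (C (P.eval d))) + e := by
    rw [smul_eq_xfun_mul]; ring
  rw [h4]
  refine add_mem (Ideal.mul_mem_mul hf ?_) he
  rw [AffinePoint.mem_ideal_iff, map_sub, AffinePoint.eval_C, sub_self]

/-- Vanishing on an effective divisor of degree `d` imposes at most `d` linear conditions. -/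
theorem exists_submodule_le_idealProd (W : Submodule ℂ L.CoordRing) [FiniteDimensional ℂ W]
    (s : Multiset L.AffinePoint) : ∃ V ≤ W, (∀ h ∈ V, h ∈ idealProd s) ∧
      Module.finrank ℂ W ≤ Module.finrank ℂ V + Multiset.card s := by
  induction s using Multiset.induction_on with
  | empty => exact ⟨W, le_rfl, by simp, by simp⟩
  | cons P s ih =>
    obtain ⟨V, hVW, hV, hd⟩ := ih
    have : FiniteDimensional ℂ V := Submodule.finiteDimensional_of_le hVW
    rw [idealProd_cons, mul_comm]
    set J : Submodule ℂ L.CoordRing := (idealProd s * P.ideal).restrictScalars ℂ with hJ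
    refine ⟨V ⊓ J, inf_le_left.trans hVW, fun h hh => hh.2, ?_⟩
    rw [Multiset.card_cons]
    by_cases hc : V ≤ J
    · rw [inf_eq_left.2 hc]; omega
    · obtain ⟨f, hfV, hfJ⟩ := SetLike.not_le_iff_exists.1 hc
      -- One vector `f` spans a complement of `V ⊓ J` in `V`, so the new point costs at most one
      -- dimension.
      have h1 : V ≤ (V ⊓ J) ⊔ Submodule.span ℂ {f} := by
        intro g hg
        obtain ⟨z, hz⟩ := exists_sub_smul_mem (idealProd_ne_bot s) P (hV f hfV) hfJ (hV g hg)
        rw [Submodule.mem_sup]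
        refine ⟨g - z • f, ⟨sub_mem hg (V.smul_mem _ hfV), hz⟩, z • f,
          Submodule.smul_mem _ _ (Submodule.mem_span_singleton_self f), by abel⟩
      have : FiniteDimensional ℂ (V ⊓ J : Submodule ℂ L.CoordRing) :=
        Submodule.finiteDimensional_of_le inf_le_left
      have h2 := Submodule.finrank_mono h1
      have h3 := Submodule.finrank_add_le_finrank_add_finrank (V ⊓ J) (Submodule.span ℂ {f})
      have h4 := finrank_span_singleton (K := ℂ) (v := f) (by rintro rfl; exact hfJ J.zero_mem)
      omega

end Dedekind

/-- The functions `c₀ + c₁ x + c₂ x² + c₃ y`, whose poles at infinity have order at most `5`. -/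
def lowWeight (L : Genus2) : (Fin 4 → ℂ) →ₗ[ℂ] L.CoordRing where
  toFun v := L.func (C (v 0) + C (v 1) * X + C (v 2) * X ^ 2) (C (v 3))
  map_add' v w := by
    rw [func_add]
    congr 1 <;> simp only [Pi.add_apply, C_add]
    ring
  map_smul' z v := by
    rw [RingHom.id_apply, smul_eq_xfun_mul, ← func_zero_right, func_mul]
    congr 1 <;> simp only [Pi.smul_apply, smul_eq_mul, C_mul] <;> ring

theorem lowWeight_apply (v : Fin 4 → ℂ) :
    L.lowWeight v = L.func (C (v 0) + C (v 1) * X + C (v 2) * X ^ 2) (C (v 3)) := rfl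

theorem lowWeight_injective (L : Genus2) : Function.Injective L.lowWeight := by
  rw [injective_iff_map_eq_zero]
  intro v hv
  rw [lowWeight_apply, func_eq_zero_iff] at hv
  obtain ⟨h1, h2⟩ := hv
  have e0 := congrArg (fun p => coeff p 0) h1
  have e1 := congrArg (fun p => coeff p 1) h1
  have e2 := congrArg (fun p => coeff p 2) h1
  simp [coeff_X, coeff_C] at e0 e1 e2
  rw [C_eq_zero] at h2
  ext i
  fin_cases i <;> simp [e0, e1, e2, h2]

theorem weight_lowWeight_le (v : Fin 4 → ℂ) :
    weight (C (v 0) + C (v 1) * X + C (v 2) * X ^ 2) (C (v 3)) ≤ 5 := by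
  have : (C (v 0) + C (v 1) * X + C (v 2) * X ^ 2).natDegree ≤ 2 := by compute_degree
  rw [weight, natDegree_C]
  split_ifs <;> omega

theorem AffinePoint.ideal_eq_span_of_eval {P : L.AffinePoint} {V : ℂ[X]}
    (h : P.y = V.eval P.x) : P.ideal = Ideal.span {L.xfun (X - C P.x), L.yfun - L.xfun V} := by
  obtain ⟨k, hk⟩ := X_sub_C_dvd_sub_C_eval (a := P.x) (p := V)
  have e : L.yfun - L.xfun V = L.yfun - L.xfun (C P.y) + (-L.xfun k) * L.xfun (X - C P.x) := by
    have := congrArg L.xfun hk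
    rw [map_sub, map_mul, ← h] at this
    linear_combination -this
  rw [ideal_eq, e, Ideal.span_pair_add_mul_left]

section Dedekind

variable [hL : Fact L.Nondegenerate]

/-- Functions of weight at most 5 form a space of dimension 4, so a nonzero one vanishes at the
three points. It has at most two further zeros, and their conjugates represent the sum. -/
theorem exists_card_le_two_of_three (P Q R : L.AffinePoint) :
    ∃ t : Multiset L.AffinePoint, Multiset.card t ≤ 2 ∧
      P.cls + Q.cls + R.cls = (t.map AffinePoint.cls).sum := by
  obtain ⟨V, hVW, hV, hd⟩ :=
    exists_submodule_le_idealProd (LinearMap.range L.lowWeight) {P, Q, R}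
  rw [LinearMap.finrank_range_of_inj L.lowWeight_injective] at hd
  simp at hd
  have hV0 : V ≠ ⊥ := by
    rintro rfl
    simp at hd
  obtain ⟨h, hh, h0⟩ := Submodule.exists_mem_ne_zero_of_ne_bot hV0
  obtain ⟨v, rfl⟩ := hVW hh
  obtain ⟨u, hu⟩ := exists_eq_idealProd (L := L) (I := Ideal.span {L.lowWeight v}) (by simpa)
  have h1 := hV _ hh
  rw [← Ideal.span_singleton_le_iff_mem, hu, idealProd_le_iff, Multiset.le_iff_exists_add] at h1
  obtain ⟨t, rfl⟩ := h1
  have h2 := sum_cls_eq_zero_iff.2 ⟨_, hu⟩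
  have h3 := (weight_eq_card hu).symm.trans_le (weight_lowWeight_le v)
  refine ⟨t.map AffinePoint.invol, ?_, ?_⟩
  · simp at h3 ⊢
    omega
  · rw [Multiset.map_map]
    have h4 : (AffinePoint.cls ∘ AffinePoint.invol : L.AffinePoint → L.Jac) =
        fun P => -P.cls := by
      funext P; exact P.cls_invol
    rw [h4, Multiset.sum_map_neg, eq_neg_iff_add_eq_zero, ← h2]
    simp [add_assoc]

/-- Points are added one at a time, with a reduction after each; subtracting a point is adding its
conjugate. -/
theorem exists_card_le_two (c : L.Jac) : ∃ t : Multiset L.AffinePoint, Multiset.card t ≤ 2 ∧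
    c = (t.map AffinePoint.cls).sum := by
  have step : ∀ (P : L.AffinePoint) (c : L.Jac),
      (∃ t : Multiset L.AffinePoint, Multiset.card t ≤ 2 ∧ c = (t.map AffinePoint.cls).sum) →
      ∃ t : Multiset L.AffinePoint, Multiset.card t ≤ 2 ∧
        c + P.cls = (t.map AffinePoint.cls).sum := by
    rintro P c ⟨t, ht, rfl⟩
    rcases Nat.lt_or_ge (Multiset.card t) 2 with h | h
    · exact ⟨P ::ₘ t, by rw [Multiset.card_cons]; omega, by simp [add_comm]⟩
    · obtain ⟨Q, R, rfl⟩ := Multiset.card_eq_two.1 (le_antisymm ht h)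
      simpa using exists_card_le_two_of_three Q R P
  have key : ∀ (D : L.Divisor) (c : L.Jac),
      (∃ t : Multiset L.AffinePoint, Multiset.card t ≤ 2 ∧ c = (t.map AffinePoint.cls).sum) →
      ∃ t : Multiset L.AffinePoint, Multiset.card t ≤ 2 ∧
        c + L.jacHom D = (t.map AffinePoint.cls).sum := by
    intro D
    induction D using Finsupp.induction_linear with
    | zero => intro c hc; simpa using hc
    | add D E hD hE =>
      intro c hc
      rw [map_add, ← add_assoc]
      exact hE _ (hD c hc)
    | single P n =>
      intro c hc
      cases P with
      | infinity => rwa [jacHom_infinity, add_zero]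
      | affine P =>
        have e : L.jacHom (Finsupp.single (Point.affine P) n) = n • P.cls := by
          rw [AffinePoint.cls, ← map_zsmul, Finsupp.smul_single, smul_eq_mul, mul_one]
        rw [e]
        clear e
        induction n using Int.induction_on with
        | zero => simpa using hc
        | succ n ih =>
          rw [add_zsmul, one_zsmul, ← add_assoc]
          exact step P _ ih
        | pred n ih =>
          rw [sub_zsmul, one_zsmul, ← add_assoc, ← AffinePoint.cls_invol]
          exact step P.invol _ ih
  obtain ⟨D, rfl⟩ := L.jacHom_surjective c
  simpa using key D 0 ⟨0, by simp, by simp⟩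

/-- Every class is zero, special or non-special. -/
theorem eq_zero_or_isSpecial_or_isNonSpecial (c : L.Jac) :
    c = 0 ∨ IsSpecial c ∨ IsNonSpecial c := by
  obtain ⟨t, ht, rfl⟩ := exists_card_le_two c
  rw [isSpecial_iff, isNonSpecial_iff]
  have h3 : Multiset.card t = 0 ∨ Multiset.card t = 1 ∨ Multiset.card t = 2 := by omega
  rcases h3 with h | h | h
  · rw [Multiset.card_eq_zero] at h
    simp [h]
  · obtain ⟨P, rfl⟩ := Multiset.card_eq_one.1 h
    exact Or.inr (Or.inl ⟨P, by simp⟩)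
  · obtain ⟨P, Q, rfl⟩ := Multiset.card_eq_two.1 h
    by_cases hPQ : Q = P.invol
    · exact Or.inl (by simpa using AffinePoint.cls_add_cls_eq_zero_iff.2 hPQ)
    · exact Or.inr (Or.inr ⟨P, Q, hPQ, by simp⟩)

/-! ### Functions `y - V(x)` -/

/-- Mumford's representation of a divisor on a graph, multiplicities included. In the induction the
product of `(x - x_P, g)` and `(M, g)`, with `g = y - V`, must be shown to contain `g` itself. If
`M(x_P) ≠ 0`, reduce `g M` modulo `(x - x_P) g`. Otherwise use `g (g + 2V) = 𝒫 - V²`, a multiple of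
`(x - x_P) M`. -/
theorem idealProd_eq_span_pair {V : ℂ[X]} {s : Multiset L.AffinePoint}
    (hy : ∀ P ∈ s, P.y = V.eval P.x)
    (hs : (s.map fun P => X - C P.x).prod ∣ L.poly - V ^ 2) :
    idealProd s =
      Ideal.span {L.xfun (s.map fun P => X - C P.x).prod, L.yfun - L.xfun V} := by
  induction s using Multiset.induction_on with
  | empty =>
    rw [idealProd_zero, Ideal.one_eq_top, eq_comm, Ideal.eq_top_iff_one]
    exact Ideal.subset_span (by simp)
  | cons P s ih =>
    rw [Multiset.map_cons, Multiset.prod_cons] at hs ⊢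
    have hP := hy P (Multiset.mem_cons_self P s)
    rw [idealProd_cons, ih (fun Q hQ => hy Q (Multiset.mem_cons_of_mem hQ))
      ((dvd_mul_left _ _).trans hs), AffinePoint.ideal_eq_span_of_eval hP,
      Ideal.span_pair_mul_span_pair]
    set M := (s.map fun P => X - C P.x).prod
    set g := L.yfun - L.xfun V with hg
    obtain ⟨N, hN⟩ := hs
    obtain ⟨m, hm⟩ := X_sub_C_dvd_sub_C_eval (a := P.x) (p := M)
    obtain ⟨v, hv⟩ := X_sub_C_dvd_sub_C_eval (a := P.x) (p := V)
    apply le_antisymm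
    · rw [Ideal.span_le]
      have hg' : g ∈ Ideal.span {L.xfun ((X - C P.x) * M), g} := Ideal.subset_span (by simp)
      rintro _ (rfl | rfl | rfl | rfl)
      · rw [← map_mul]
        exact Ideal.subset_span (by simp)
      · exact Ideal.mul_mem_left _ _ hg'
      · exact Ideal.mul_mem_right _ _ hg'
      · exact Ideal.mul_mem_right _ _ hg'
    · set I := Ideal.span {L.xfun (X - C P.x) * L.xfun M, L.xfun (X - C P.x) * g,
        g * L.xfun M, g * g}
      have h1 : L.xfun (X - C P.x) * L.xfun M ∈ I := Ideal.subset_span (by simp)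
      have h2 : L.xfun (X - C P.x) * g ∈ I := Ideal.subset_span (by simp)
      have h3 : g * L.xfun M ∈ I := Ideal.subset_span (by simp)
      have h4 : g * g ∈ I := Ideal.subset_span (by simp)
      have unit : ∀ c : ℂ, c ≠ 0 → L.xfun (C c) * g ∈ I → g ∈ I := fun c hc h =>
        (Ideal.unit_mul_mem_iff_mem _
          (IsUnit.map _ (isUnit_C.2 (isUnit_iff_ne_zero.2 hc)))).1 h
      have hgI : g ∈ I := by
        by_cases hM : M.eval P.x = 0
        -- A repeated point is not a branch point: `V(x_P) = 0` would make `𝒫` divisible by `(x -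
        -- x_P)²`.
        · have hV : V.eval P.x ≠ 0 := by
            intro hV
            rw [hM, C_0, sub_zero] at hm
            rw [hV, C_0, sub_zero] at hv
            refine hL.out.not_sq_dvd P.x ⟨m * N + v ^ 2, ?_⟩
            rw [sub_eq_iff_eq_add.1 hN, hm, hv]
            ring
          refine unit (2 * V.eval P.x) (mul_ne_zero two_ne_zero hV) ?_
          have e : L.xfun (C (2 * V.eval P.x)) * g = L.xfun N * (L.xfun (X - C P.x) * L.xfun M)
              - g * g - 2 * L.xfun v * (L.xfun (X - C P.x) * g) := by
            have e1 := congrArg L.xfun hN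
            have e2 := congrArg L.xfun hv
            rw [map_sub, map_mul] at e2
            rw [map_mul, map_mul, map_sub, map_pow, ← yfun_sq] at e1
            rw [C_mul, map_mul, hg, C_ofNat, map_ofNat]
            linear_combination e1 - 2 * (L.yfun - L.xfun V) * e2
          rw [e]
          exact sub_mem (sub_mem (Ideal.mul_mem_left _ _ h1) h4) (Ideal.mul_mem_left _ _ h2)
        · refine unit _ hM ?_
          have e : L.xfun (C (M.eval P.x)) * g =
              g * L.xfun M - L.xfun m * (L.xfun (X - C P.x) * g) := by
            have e1 := congrArg L.xfun hm
            rw [map_sub, map_mul] at e1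
            linear_combination -g * e1
          rw [e]
          exact sub_mem h3 (Ideal.mul_mem_left _ _ h2)
      rw [Ideal.span_le]
      rintro _ (rfl | rfl)
      · rw [map_mul]; exact h1
      · exact hgI

/-- The intersection of the curve with the graph of a polynomial `V(x)` has trivial class. -/
theorem sum_cls_eq_zero_of_graph {V : ℂ[X]} {s : Multiset L.AffinePoint}
    (hy : ∀ P ∈ s, P.y = V.eval P.x) {c : ℂ} (hc : c ≠ 0)
    (hs : L.poly - V ^ 2 = C c * (s.map fun P => X - C P.x).prod) :
    (s.map AffinePoint.cls).sum = 0 := by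
  rw [sum_cls_eq_zero_iff]
  refine ⟨L.yfun - L.xfun V, ?_⟩
  rw [idealProd_eq_span_pair hy ⟨C c, by rw [hs, mul_comm]⟩]
  set M := (s.map fun P => X - C P.x).prod
  refine le_antisymm (Ideal.span_mono (by simp)) ?_
  rw [Ideal.span_le]
  rintro _ (rfl | rfl)
  · refine (Ideal.unit_mul_mem_iff_mem _
      (IsUnit.map L.xfun (isUnit_C.2 (isUnit_iff_ne_zero.2 hc)))).1 ?_
    rw [← map_mul, ← hs, Ideal.mem_span_singleton]
    refine ⟨L.yfun + L.xfun V, ?_⟩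
    rw [map_sub, ← yfun_sq, map_pow]
    ring
  · exact Ideal.mem_span_singleton_self _

end Dedekind

/-! ### Division by two -/

/-- The point of the curve over a root `q` of `𝒫 - V²`, on the graph of `V`. -/
def graphPoint (V : ℂ[X]) (q : ℂ) (h : (L.poly - V ^ 2).eval q = 0) : L.AffinePoint :=
  ⟨q, V.eval q, by rw [eval_sub, sub_eq_zero, eval_pow] at h; exact h.symm⟩

theorem exists_quadratic_factors (u v : ℂ) :
    ∃ q₁ q₂ : ℂ, u = -(q₁ + q₂) ∧ v = q₁ * q₂ := by
  obtain ⟨s, hs⟩ := IsAlgClosed.exists_pow_nat_eq (u ^ 2 - 4 * v) two_pos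
  refine ⟨(-u + s) / 2, (-u - s) / 2, by ring, ?_⟩
  linear_combination (1 / 4) * hs

/-- Each root `α` is written as `a - r²`. -/
theorem exists_eq_prod_five (L : Genus2) (a : ℂ) : ∃ r₁ r₂ r₃ r₄ r₅ : ℂ,
    L.poly = (X - C a + C (r₁ ^ 2)) * (X - C a + C (r₂ ^ 2)) * (X - C a + C (r₃ ^ 2)) *
      (X - C a + C (r₄ ^ 2)) * (X - C a + C (r₅ ^ 2)) := by
  have key : ∀ n : ℕ, ∀ p : ℂ[X], p.natDegree = n + 1 → p.Monic →
      ∃ r : ℂ, ∃ q : ℂ[X], p = q * (X - C a + C (r ^ 2)) ∧ q.natDegree = n ∧ q.Monic := by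
    intro n p hp hm
    obtain ⟨z, hz⟩ := IsAlgClosed.exists_root p (by
      rw [degree_eq_natDegree hm.ne_zero, hp]
      exact_mod_cast Nat.succ_ne_zero n)
    obtain ⟨q, hq⟩ := dvd_iff_isRoot.2 hz
    obtain ⟨r, hr⟩ := IsAlgClosed.exists_pow_nat_eq (a - z) two_pos
    have hqm : q.Monic := (monic_X_sub_C z).of_mul_monic_left (hq ▸ hm)
    refine ⟨r, q, ?_, ?_, hqm⟩
    · rw [hq, hr, C_sub]; ring
    · rw [hq, (monic_X_sub_C z).natDegree_mul hqm, natDegree_X_sub_C] at hp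
      omega
  obtain ⟨r₅, q₅, h5, d5, m5⟩ := key 4 L.poly L.natDegree_poly L.monic_poly
  obtain ⟨r₄, q₄, h4, d4, m4⟩ := key 3 q₅ d5 m5
  obtain ⟨r₃, q₃, h3, d3, m3⟩ := key 2 q₄ d4 m4
  obtain ⟨r₂, q₂, h2, d2, m2⟩ := key 1 q₃ d3 m3
  obtain ⟨r₁, q₁, h1, d1, m1⟩ := key 0 q₂ d2 m2
  refine ⟨r₁, r₂, r₃, r₄, r₅, ?_⟩
  rw [h5, h4, h3, h2, h1, m1.natDegree_eq_zero.1 d1, one_mul]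

/-- A decomposition `𝒫 = V² + (x - a) (x - q₁)² (x - q₂)²`, from square roots of the numbers
`a - α` for the roots `α` of `𝒫`. -/
theorem exists_poly_sub_sq_eq (L : Genus2) (a : ℂ) : ∃ (V : ℂ[X]) (q₁ q₂ : ℂ),
    L.poly - V ^ 2 = (X - C a) * ((X - C q₁) * (X - C q₂)) ^ 2 := by
  -- Put `t = x - a` and let `e_k` be the elementary symmetric functions of the `r_i`. Split `∏ (r_i
  -- + s)` into even and odd parts in `s`, multiply by `∏ (r_i - s)` and set `s² = -t`. The result
  -- is `∏ (t + r_i²) = (e₁ t² - e₃ t + e₅)² + t (t² - e₂ t + e₄)²`, and `p₁`, `p₂` are the roots of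
  -- the last quadratic.
  obtain ⟨r₁, r₂, r₃, r₄, r₅, h⟩ := L.exists_eq_prod_five a
  obtain ⟨p₁, p₂, h1, h2⟩ := exists_quadratic_factors
    (-(r₁ * r₂ + r₁ * r₃ + r₁ * r₄ + r₁ * r₅ + r₂ * r₃ + r₂ * r₄ + r₂ * r₅ + r₃ * r₄ + r₃ * r₅ +
      r₄ * r₅))
    (r₁ * r₂ * r₃ * r₄ + r₁ * r₂ * r₃ * r₅ + r₁ * r₂ * r₄ * r₅ + r₁ * r₃ * r₄ * r₅ +
      r₂ * r₃ * r₄ * r₅)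
  have h1' := congrArg (C : ℂ →+* ℂ[X]) h1
  have h2' := congrArg (C : ℂ →+* ℂ[X]) h2
  simp only [map_add, map_mul, map_neg] at h1' h2'
  have e : (X - C (a + p₁)) * (X - C (a + p₂)) = (X - C a) ^ 2 -
      (C r₁ * C r₂ + C r₁ * C r₃ + C r₁ * C r₄ + C r₁ * C r₅ + C r₂ * C r₃ + C r₂ * C r₄ +
        C r₂ * C r₅ + C r₃ * C r₄ + C r₃ * C r₅ + C r₄ * C r₅) * (X - C a) +
      (C r₁ * C r₂ * C r₃ * C r₄ + C r₁ * C r₂ * C r₃ * C r₅ + C r₁ * C r₂ * C r₄ * C r₅ +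
        C r₁ * C r₃ * C r₄ * C r₅ + C r₂ * C r₃ * C r₄ * C r₅) := by
    simp only [map_add]
    linear_combination (-(X - C a)) * h1' - h2'
  refine ⟨(C r₁ + C r₂ + C r₃ + C r₄ + C r₅) * (X - C a) ^ 2 -
    (C r₁ * C r₂ * C r₃ + C r₁ * C r₂ * C r₄ + C r₁ * C r₂ * C r₅ + C r₁ * C r₃ * C r₄ +
      C r₁ * C r₃ * C r₅ + C r₁ * C r₄ * C r₅ + C r₂ * C r₃ * C r₄ + C r₂ * C r₃ * C r₅ +
      C r₂ * C r₄ * C r₅ + C r₃ * C r₄ * C r₅) * (X - C a) + C r₁ * C r₂ * C r₃ * C r₄ * C r₅,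
    a + p₁, a + p₂, ?_⟩
  rw [e, h]
  simp only [map_pow]
  ring

theorem AffinePoint.ne_invol_of_ne {P Q : L.AffinePoint} (hP : P.y = 0) (h : P ≠ Q) :
    Q ≠ P.invol := by
  rw [P.invol_eq_self_iff.2 hP]; exact h.symm

section Dedekind

variable [hL : Fact L.Nondegenerate]

/-- The graph of `V` cuts out `A + 2B + 2D` with `A` over `x_P`. So `A` is `P` or its conjugate, and
`B + D` is a half of `P` up to sign. -/
theorem AffinePoint.exists_two_nsmul_eq_cls (P : L.AffinePoint) : ∃ d : L.Jac, 2 • d = P.cls := by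
  obtain ⟨V, q₁, q₂, h⟩ := L.exists_poly_sub_sq_eq P.x
  set A : L.AffinePoint := graphPoint V P.x (by simp [h])
  set B : L.AffinePoint := graphPoint V q₁ (by simp [h])
  set D : L.AffinePoint := graphPoint V q₂ (by simp [h])
  have h1 := sum_cls_eq_zero_of_graph (V := V) (s := {A, B, B, D, D})
    (by
      intro Q hQ
      simp only [Multiset.insert_eq_cons, Multiset.mem_cons, Multiset.mem_singleton] at hQ
      rcases hQ with rfl | rfl | rfl | rfl | rfl <;> rfl) one_ne_zero
    (by
      rw [h]
      simp only [Multiset.insert_eq_cons, Multiset.map_cons, Multiset.map_singleton,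
        Multiset.prod_cons, Multiset.prod_singleton, C_1]
      change _ = 1 * ((X - C P.x) * ((X - C q₁) * ((X - C q₁) * ((X - C q₂) * (X - C q₂)))))
      ring)
  simp only [Multiset.insert_eq_cons, Multiset.map_cons, Multiset.map_singleton,
        Multiset.sum_cons, Multiset.sum_singleton] at h1
  have h2 : A.cls = - (2 • (B.cls + D.cls)) := by
    rw [eq_neg_iff_add_eq_zero, ← h1, two_nsmul]; abel
  rcases eq_or_eq_invol (P := A) (Q := P) rfl with h3 | h3
  · exact ⟨-(B.cls + D.cls), by rw [h3, h2, two_nsmul, two_nsmul]; abel⟩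
  · exact ⟨B.cls + D.cls, by rw [h3, cls_invol, h2, neg_neg]⟩

theorem exists_two_nsmul_eq (c : L.Jac) : ∃ d : L.Jac, 2 • d = c := by
  obtain ⟨t, -, rfl⟩ := exists_card_le_two c
  induction t using Multiset.induction_on with
  | empty => exact ⟨0, by simp⟩
  | cons P t ih =>
    obtain ⟨d, hd⟩ := P.exists_two_nsmul_eq_cls
    obtain ⟨e, he⟩ := ih
    exact ⟨d + e, by rw [nsmul_add, hd, he]; simp⟩

/-! ### Counting -/

theorem ncard_roots (L : Genus2) [hL : Fact L.Nondegenerate] :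
    Set.ncard {a : ℂ | L.poly.eval a = 0} = 5 := by
  have h1 : {a : ℂ | L.poly.eval a = 0} = (L.poly.roots.toFinset : Set ℂ) := by
    ext a
    simp [L.poly_ne_zero]
  have h2 : L.poly.roots.Nodup :=
    nodup_roots (PerfectField.separable_iff_squarefree.2 hL.out)
  rw [h1, Set.ncard_coe_finset, Multiset.toFinset_card_of_nodup h2,
    ← (IsAlgClosed.splits L.poly).natDegree_eq_card_roots, natDegree_poly]

theorem ncard_branchPoints (L : Genus2) [hL : Fact L.Nondegenerate] :
    Set.ncard {P : L.AffinePoint | P.y = 0} = 5 := by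
  rw [← ncard_roots L]
  refine Set.ncard_congr (fun P _ => P.x) ?_ ?_ ?_
  · intro P (hP : P.y = 0)
    rw [Set.mem_ofPred_eq, ← P.eqn, hP]
    ring
  · intro P Q (hP : P.y = 0) (hQ : Q.y = 0) h
    exact AffinePoint.ext h (hP.trans hQ.symm)
  · intro a ha
    exact ⟨⟨a, 0, by rw [show L.poly.eval a = 0 from ha]; ring⟩, rfl, rfl⟩

theorem ncard_two_torsion_isSpecial (L : Genus2) [hL : Fact L.Nondegenerate] :
    Set.ncard {c : L.Jac | 2 • c = 0 ∧ IsSpecial c} = 5 := by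
  have h : {c : L.Jac | 2 • c = 0 ∧ IsSpecial c} =
      AffinePoint.cls '' {P : L.AffinePoint | P.y = 0} := by
    ext c
    simp only [Set.mem_ofPred_eq, isSpecial_iff, Set.mem_image]
    constructor
    · rintro ⟨h, P, rfl⟩
      exact ⟨P, AffinePoint.two_nsmul_cls_eq_zero_iff.1 h, rfl⟩
    · rintro ⟨P, h, rfl⟩
      exact ⟨AffinePoint.two_nsmul_cls_eq_zero_iff.2 h, P, rfl⟩
  rw [h, Set.ncard_image_of_injective _ AffinePoint.cls_injective, ncard_branchPoints]

theorem finite_branchPoints (L : Genus2) [hL : Fact L.Nondegenerate] :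
    Set.Finite {P : L.AffinePoint | P.y = 0} :=
  Set.finite_of_ncard_ne_zero (by rw [ncard_branchPoints]; norm_num)

/-- These classes correspond to the two-element subsets of the five branch points. -/
theorem ncard_two_torsion_isNonSpecial (L : Genus2) [hL : Fact L.Nondegenerate] :
    Set.ncard {c : L.Jac | 2 • c = 0 ∧ IsNonSpecial c} = 10 := by
  classical
  set T := (finite_branchPoints L).toFinset with hT
  have hTmem : ∀ P : L.AffinePoint, P ∈ T ↔ P.y = 0 := by simp [hT]
  have hTc : T.card = 5 := by
    rw [← ncard_branchPoints L, Set.ncard_eq_toFinset_card _ (finite_branchPoints L)]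
  have h : {c : L.Jac | 2 • c = 0 ∧ IsNonSpecial c} =
      (fun s : Finset L.AffinePoint => ∑ P ∈ s, P.cls) '' (T.powersetCard 2 : Set _) := by
    ext c
    simp only [Set.mem_ofPred_eq, isNonSpecial_iff, Set.mem_image, Finset.mem_coe,
      Finset.mem_powersetCard]
    constructor
    · rintro ⟨h, P, Q, hPQ, rfl⟩
      obtain ⟨hP, hQ⟩ := (AffinePoint.two_nsmul_cls_add_cls_eq_zero_iff hPQ).1 h
      have hne : P ≠ Q := by
        rintro rfl
        exact hPQ (P.invol_eq_self_iff.2 hP).symm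
      refine ⟨{P, Q}, ⟨?_, Finset.card_pair hne⟩, Finset.sum_pair hne⟩
      intro R hR
      rw [hTmem]
      rcases Finset.mem_insert.1 hR with rfl | hR
      · exact hP
      · rwa [Finset.mem_singleton.1 hR]
    · rintro ⟨s, ⟨hs, hc⟩, rfl⟩
      obtain ⟨P, Q, hne, rfl⟩ := Finset.card_eq_two.1 hc
      have hP := (hTmem P).1 (hs (by simp))
      have hQ := (hTmem Q).1 (hs (by simp))
      have hPQ := AffinePoint.ne_invol_of_ne hP hne
      rw [Finset.sum_pair hne]
      exact ⟨(AffinePoint.two_nsmul_cls_add_cls_eq_zero_iff hPQ).2 ⟨hP, hQ⟩, P, Q, hPQ, rfl⟩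
  rw [h, Set.InjOn.ncard_image, Set.ncard_coe_finset, Finset.card_powersetCard, hTc]
  · rfl
  · intro s hs t ht hst
    rw [Finset.mem_coe, Finset.mem_powersetCard] at hs ht
    obtain ⟨P, Q, hne, rfl⟩ := Finset.card_eq_two.1 hs.2
    obtain ⟨R, S, hne', rfl⟩ := Finset.card_eq_two.1 ht.2
    have hPQ := AffinePoint.ne_invol_of_ne ((hTmem P).1 (hs.1 (by simp))) hne
    simp only [Finset.sum_pair hne, Finset.sum_pair hne'] at hst
    rcases (AffinePoint.cls_add_cls_eq_iff hPQ).1 hst with ⟨rfl, rfl⟩ | ⟨rfl, rfl⟩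
    · rfl
    · exact Finset.pair_comm _ _

theorem ncard_two_torsion (L : Genus2) [hL : Fact L.Nondegenerate] :
    Set.ncard {c : L.Jac | 2 • c = 0} = 16 := by
  have h : {c : L.Jac | 2 • c = 0} = {0} ∪ ({c : L.Jac | 2 • c = 0 ∧ IsSpecial c} ∪
      {c : L.Jac | 2 • c = 0 ∧ IsNonSpecial c}) := by
    ext c
    simp only [Set.mem_ofPred_eq, Set.mem_union, Set.mem_singleton_iff]
    constructor
    · intro h
      rcases eq_zero_or_isSpecial_or_isNonSpecial c with h1 | h1 | h1
      · exact Or.inl h1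
      · exact Or.inr (Or.inl ⟨h, h1⟩)
      · exact Or.inr (Or.inr ⟨h, h1⟩)
    · rintro (rfl | h | h)
      · simp
      · exact h.1
      · exact h.1
  have f1 := Set.finite_of_ncard_ne_zero (s := {c : L.Jac | 2 • c = 0 ∧ IsSpecial c})
    (by rw [ncard_two_torsion_isSpecial]; norm_num)
  have f2 := Set.finite_of_ncard_ne_zero (s := {c : L.Jac | 2 • c = 0 ∧ IsNonSpecial c})
    (by rw [ncard_two_torsion_isNonSpecial]; norm_num)
  rw [h, Set.ncard_union_eq _ (Set.finite_singleton _) (f1.union f2), Set.ncard_union_eq _ f1 f2,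
    ncard_two_torsion_isSpecial, ncard_two_torsion_isNonSpecial, Set.ncard_singleton]
  · rw [Set.disjoint_left]
    rintro c ⟨-, h1⟩ ⟨-, h2⟩
    exact h2.not_isSpecial h1
  · rw [Set.disjoint_left]
    rintro c rfl (⟨-, h⟩ | ⟨-, h⟩)
    · exact h.ne_zero rfl
    · exact h.ne_zero rfl

end Dedekind

/-- A set-theoretic section `r` of `f` identifies the preimage with `S × ker f`. -/
theorem ncard_preimage_of_surjective {G H : Type*} [AddCommGroup G] [AddCommGroup H] (f : G →+ H)
    (hf : Function.Surjective f) (S : Set H) :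
    Set.ncard (f ⁻¹' S) = Set.ncard S * Set.ncard {g | f g = 0} := by
  choose r hr using hf
  rw [← Nat.card_coe_set_eq, ← Nat.card_coe_set_eq, ← Nat.card_coe_set_eq, ← Nat.card_prod]
  exact Nat.card_congr
    { toFun := fun g => ⟨⟨f g, g.2⟩, ⟨g - r (f g), by simp [hr]⟩⟩
      invFun := fun p => ⟨r p.1 + p.2, by
        have := p.2.2
        simp only [Set.mem_ofPred_eq] at this
        simp [hr, this]⟩
      left_inv := fun g => by simp
      right_inv := fun p => by
        have h := p.2.2
        simp only [Set.mem_ofPred_eq] at h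
        ext <;> simp [hr, h] }

theorem addOrderOf_eq_four_iff {G : Type*} [AddGroup G] {g : G} :
    addOrderOf g = 4 ↔ 2 • (2 • g) = 0 ∧ 2 • g ≠ 0 := by
  rw [← mul_nsmul]
  constructor
  · intro h
    refine ⟨(show 2 * 2 = addOrderOf g from h.symm) ▸ addOrderOf_nsmul_eq_zero g, fun h2 => ?_⟩
    have := addOrderOf_dvd_of_nsmul_eq_zero h2
    rw [h] at this
    norm_num at this
  · rintro ⟨h1, h2⟩
    exact addOrderOf_eq_prime_pow (p := 2) (n := 1) (by simpa using h2) (by simpa using h1)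

section Dedekind

variable [hL : Fact L.Nondegenerate]

theorem ncard_two_nsmul_mem (S : Set L.Jac) :
    Set.ncard {c : L.Jac | 2 • c ∈ S} = Set.ncard S * 16 := by
  rw [← ncard_two_torsion L]
  exact ncard_preimage_of_surjective (nsmulAddMonoidHom (α := L.Jac) 2) exists_two_nsmul_eq S

/-- Order four means that `2c` is nonzero and killed by 2. Non-special classes are nonzero, so the
set is the full preimage under doubling of the 10 non-special 2-torsion classes. -/
theorem ncard_order_four_isNonSpecial (L : Genus2) [hL : Fact L.Nondegenerate] :
    Set.ncard {c : L.Jac | addOrderOf c = 4 ∧ IsNonSpecial ((2 : ℕ) • c)} = 160 := by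
  have h : {c : L.Jac | addOrderOf c = 4 ∧ IsNonSpecial ((2 : ℕ) • c)} =
      {c : L.Jac | 2 • c ∈ {d : L.Jac | 2 • d = 0 ∧ IsNonSpecial d}} := by
    ext c
    simp only [Set.mem_ofPred_eq, addOrderOf_eq_four_iff]
    exact ⟨fun h => ⟨h.1.1, h.2⟩, fun h => ⟨⟨h.1, h.2.ne_zero⟩, h.2⟩⟩
  rw [h, ncard_two_nsmul_mem, ncard_two_torsion_isNonSpecial]

theorem ncard_order_four_isSpecial (L : Genus2) [hL : Fact L.Nondegenerate] :
    Set.ncard {c : L.Jac | addOrderOf c = 4 ∧ IsSpecial ((2 : ℕ) • c)} = 80 := by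
  have h : {c : L.Jac | addOrderOf c = 4 ∧ IsSpecial ((2 : ℕ) • c)} =
      {c : L.Jac | 2 • c ∈ {d : L.Jac | 2 • d = 0 ∧ IsSpecial d}} := by
    ext c
    simp only [Set.mem_ofPred_eq, addOrderOf_eq_four_iff]
    exact ⟨fun h => ⟨h.1.1, h.2⟩, fun h => ⟨⟨h.1, h.2.ne_zero⟩, h.2⟩⟩
  rw [h, ncard_two_nsmul_mem, ncard_two_torsion_isSpecial]

theorem isNonSpecial_or_isSpecial_of_addOrderOf_eq_four {c : L.Jac} (hc : addOrderOf c = 4) :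
    IsNonSpecial ((2 : ℕ) • c) ∨ IsSpecial ((2 : ℕ) • c) := by
  rcases eq_zero_or_isSpecial_or_isNonSpecial (2 • c) with h | h | h
  · exact absurd h (addOrderOf_eq_four_iff.1 hc).2
  · exact Or.inr h
  · exact Or.inl h

theorem ncard_order_four (L : Genus2) [hL : Fact L.Nondegenerate] :
    Set.ncard {c : L.Jac | addOrderOf c = 4} = 240 := by
  have h : {c : L.Jac | addOrderOf c = 4} =
      {c : L.Jac | addOrderOf c = 4 ∧ IsNonSpecial ((2 : ℕ) • c)} ∪
        {c : L.Jac | addOrderOf c = 4 ∧ IsSpecial ((2 : ℕ) • c)} := by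
    ext c
    simp only [Set.mem_ofPred_eq, Set.mem_union, ← and_or_left]
    exact ⟨fun h => ⟨h, isNonSpecial_or_isSpecial_of_addOrderOf_eq_four h⟩, fun h => h.1⟩
  rw [h, Set.ncard_union_eq _
    (Set.finite_of_ncard_ne_zero (by rw [ncard_order_four_isNonSpecial]; norm_num))
    (Set.finite_of_ncard_ne_zero (by rw [ncard_order_four_isSpecial]; norm_num)),
    ncard_order_four_isNonSpecial, ncard_order_four_isSpecial]
  rw [Set.disjoint_left]
  rintro c ⟨-, h1⟩ ⟨-, h2⟩
  exact h1.not_isSpecial h2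

/-- If `c = [P - ∞]` and `P` is not a branch point, then `P + P` is already reduced, and its class
is killed by 2 only if `P` is a branch point. -/
theorem isNonSpecial_of_addOrderOf_eq_four {c : L.Jac} (hc : addOrderOf c = 4) :
    IsNonSpecial c := by
  obtain ⟨h1, h2⟩ := addOrderOf_eq_four_iff.1 hc
  rcases eq_zero_or_isSpecial_or_isNonSpecial c with rfl | h | h
  · simp at h2
  · exfalso
    obtain ⟨P, rfl⟩ := isSpecial_iff.1 h
    by_cases hP : P.y = 0
    · exact h2 (AffinePoint.two_nsmul_cls_eq_zero_iff.2 hP)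
    · rw [two_nsmul P.cls, AffinePoint.two_nsmul_cls_add_cls_eq_zero_iff
        (fun h => hP (P.invol_eq_self_iff.1 h.symm))] at h1
      exact hP h1.1
  · exact h

end Dedekind

/-! ### Interpolation at the double of a divisor -/

theorem exists_eq_quadratic {p : ℂ[X]} (h : p.natDegree ≤ 2) :
    ∃ a b c : ℂ, p = C a * X ^ 2 + C b * X + C c := by
  refine ⟨p.coeff 2, p.coeff 1, p.coeff 0, ?_⟩
  conv_lhs => rw [p.as_sum_range_C_mul_X_pow' (n := 3) (by omega)]
  simp [Finset.sum_range_succ]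
  ring

theorem sq_dvd_of_eval_eq_zero {p : ℂ[X]} {a : ℂ} (h0 : p.eval a = 0)
    (h1 : p.derivative.eval a = 0) : (X - C a) ^ 2 ∣ p := by
  obtain ⟨k, rfl⟩ := dvd_iff_isRoot.2 (show p.IsRoot a from h0)
  have h2 : k.IsRoot a := by simpa using h1
  obtain ⟨l, rfl⟩ := dvd_iff_isRoot.2 h2
  exact ⟨l, by ring⟩

theorem AffinePoint.sq_dvd_poly_sub_sq {P : L.AffinePoint} {V : ℂ[X]} (hP : P.y ≠ 0)
    (h0 : V.eval P.x = P.y) (h1 : V.derivative.eval P.x = P.slope) :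
    (X - C P.x) ^ 2 ∣ L.poly - V ^ 2 := by
  refine sq_dvd_of_eval_eq_zero ?_ ?_
  · rw [eval_sub, eval_pow, h0, P.eqn, sub_self]
  · rw [slope] at h1
    simp only [derivative_sub, derivative_pow, eval_sub, eval_mul, eval_pow, h0, h1]
    field_simp
    simp

theorem AffinePoint.eval_derivative_eq_slope {P : L.AffinePoint} {V : ℂ[X]} (hP : P.y ≠ 0)
    (h0 : V.eval P.x = P.y) (h1 : (X - C P.x) ^ 2 ∣ L.poly - V ^ 2) :
    V.derivative.eval P.x = P.slope := by
  obtain ⟨k, hk⟩ := h1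
  have h2 := congrArg (fun p => p.derivative.eval P.x) hk
  simp [derivative_pow, h0, sub_eq_zero] at h2
  rw [slope, h2]
  field_simp

theorem sq_mul_dvd_poly_sub_sq {P Q : L.AffinePoint} {V : ℂ[X]} (hx : P.x ≠ Q.x) (hP : P.y ≠ 0)
    (hQ : Q.y ≠ 0) (hP0 : V.eval P.x = P.y) (hQ0 : V.eval Q.x = Q.y)
    (hP1 : V.derivative.eval P.x = P.slope) (hQ1 : V.derivative.eval Q.x = Q.slope) :
    ((X - C P.x) * (X - C Q.x)) ^ 2 ∣ L.poly - V ^ 2 := by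
  rw [mul_pow]
  refine IsCoprime.mul_dvd ?_ (P.sq_dvd_poly_sub_sq hP hP0 hP1) (Q.sq_dvd_poly_sub_sq hQ hQ0 hQ1)
  exact (isCoprime_X_sub_C_of_isUnit_sub (sub_ne_zero.2 hx).isUnit).pow

section Coordinates

variable (P Q : L.AffinePoint)

/-- Meaning of `Δ`: it vanishes exactly when the mean of the two slopes is the slope of the chord,
which is the condition for a quadratic polynomial to have the prescribed values and slopes at both
points. -/
theorem den_mul_sub (hx : P.x ≠ Q.x) :
    den P Q * (P.x - Q.x) = 2 * (P.y - Q.y) - (P.slope + Q.slope) * (P.x - Q.x) := by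
  have := sub_ne_zero.2 hx
  rw [den, dbeta3, dbeta5, alpha2]
  field_simp
  ring

theorem beta_eval_left (hx : P.x ≠ Q.x) : P.y + beta3 P Q * P.x + beta5 P Q = 0 := by
  have := sub_ne_zero.2 hx
  rw [beta3, beta5]
  field_simp
  ring

theorem beta_eval_right (hx : P.x ≠ Q.x) : Q.y + beta3 P Q * Q.x + beta5 P Q = 0 := by
  have := sub_ne_zero.2 hx
  rw [beta3, beta5]
  field_simp
  ring

theorem gamma1_ne_zero (hx : P.x ≠ Q.x) (hd : den P Q ≠ 0) : gamma1 P Q ≠ 0 := by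
  rw [gamma1]
  refine div_ne_zero ?_ hd
  have : alpha2 P Q ^ 2 - 4 * alpha4 P Q = (P.x - Q.x) ^ 2 := by rw [alpha2, alpha4]; ring
  rw [this]
  exact pow_ne_zero 2 (sub_ne_zero.2 hx)

/-- The quadratic polynomial `-(γ₁ x² + γ₃ x + γ₅)` of the special case. -/
def quadPoly : ℂ[X] := -(C (gammaS1 P Q) * X ^ 2 + C (gammaS3 P Q) * X + C (gammaS5 P Q))

/-- The cubic polynomial `x³ + γ₂ x² + γ₄ x + γ₆` of the non-special case. -/
def cubicPoly : ℂ[X] :=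
  X ^ 3 + C (gamma2 P Q) * X ^ 2 + C (gamma4 P Q) * X + C (gamma6 P Q)

theorem eval_quadPoly_left (hx : P.x ≠ Q.x) : (quadPoly P Q).eval P.x = P.y := by
  have h := beta_eval_left P Q hx
  simp [quadPoly, gammaS1, gammaS3, gammaS5, alpha2, alpha4]
  linear_combination -h

theorem eval_quadPoly_right (hx : P.x ≠ Q.x) : (quadPoly P Q).eval Q.x = Q.y := by
  have h := beta_eval_right P Q hx
  simp [quadPoly, gammaS1, gammaS3, gammaS5, alpha2, alpha4]
  linear_combination -h

theorem derivative_quadPoly (x : ℂ) :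
    (quadPoly P Q).derivative.eval x = -(2 * gammaS1 P Q * x + gammaS3 P Q) := by
  simp [quadPoly]
  ring

theorem derivative_quadPoly_left (hx : P.x ≠ Q.x) (hd : den P Q = 0) :
    (quadPoly P Q).derivative.eval P.x = P.slope := by
  have h := den_mul_sub P Q hx
  have hx' := sub_ne_zero.2 hx
  rw [hd, zero_mul] at h
  rw [derivative_quadPoly, gammaS1, gammaS3, alpha2, beta3, dbeta3]
  field_simp
  linear_combination -h

theorem derivative_quadPoly_right (hx : P.x ≠ Q.x) (hd : den P Q = 0) :
    (quadPoly P Q).derivative.eval Q.x = Q.slope := by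
  have h := den_mul_sub P Q hx
  have hx' := sub_ne_zero.2 hx
  rw [hd, zero_mul] at h
  rw [derivative_quadPoly, gammaS1, gammaS3, alpha2, beta3, dbeta3]
  field_simp
  linear_combination -h

/-- By the choice of `γ₄` and `γ₆`, the cubic is `(x + γ₂ - α₂)(x² + α₂ x + α₄) + γ₁ (β₃ x + β₅)`.
-/
theorem eval_cubicPoly_left (hx : P.x ≠ Q.x) :
    (cubicPoly P Q).eval P.x = -(gamma1 P Q * P.y) := by
  have h := beta_eval_left P Q hx
  simp [cubicPoly, gamma4, gamma6, alpha2, alpha4]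
  linear_combination gamma1 P Q * h

theorem eval_cubicPoly_right (hx : P.x ≠ Q.x) :
    (cubicPoly P Q).eval Q.x = -(gamma1 P Q * Q.y) := by
  have h := beta_eval_right P Q hx
  simp [cubicPoly, gamma4, gamma6, alpha2, alpha4]
  linear_combination gamma1 P Q * h

theorem derivative_cubicPoly (x : ℂ) : (cubicPoly P Q).derivative.eval x =
    3 * x ^ 2 + 2 * gamma2 P Q * x + gamma4 P Q := by
  simp [cubicPoly]
  ring

/-- The tangency conditions at `P` and `Q` are two linear equations in `γ₁` and `γ₂` whose
determinant is `Δ (x_P - x_Q)` up to sign; the formulas for `γ₁` and `γ₂` are their solution. -/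
theorem derivative_cubicPoly_left (hx : P.x ≠ Q.x) (hd : den P Q ≠ 0) :
    (cubicPoly P Q).derivative.eval P.x = -(gamma1 P Q * P.slope) := by
  have h := den_mul_sub P Q hx
  have hx' := sub_ne_zero.2 hx
  rw [derivative_cubicPoly, gamma4, gamma1, gamma2, alpha2, alpha4, beta3, dbeta3, dbeta5]
  generalize den P Q = d at *
  have e : d = (2 * (P.y - Q.y) - (P.slope + Q.slope) * (P.x - Q.x)) / (P.x - Q.x) := by
    rw [← h]; field_simp
  field_simp
  rw [e]
  field_simp
  ring

theorem derivative_cubicPoly_right (hx : P.x ≠ Q.x) (hd : den P Q ≠ 0) :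
    (cubicPoly P Q).derivative.eval Q.x = -(gamma1 P Q * Q.slope) := by
  have h := den_mul_sub P Q hx
  have hx' := sub_ne_zero.2 hx
  rw [derivative_cubicPoly, gamma4, gamma1, gamma2, alpha2, alpha4, beta3, dbeta3, dbeta5]
  generalize den P Q = d at *
  have e : d = (2 * (P.y - Q.y) - (P.slope + Q.slope) * (P.x - Q.x)) / (P.x - Q.x) := by
    rw [← h]; field_simp
  field_simp
  rw [e]
  field_simp
  ring

end Coordinates

/-! ### Degrees and leading coefficients of the polynomials that cut out `2 (P + Q)`. -/

theorem monic_poly_sub_sq {V : ℂ[X]} (hV : V.natDegree ≤ 2) :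
    (L.poly - V ^ 2).Monic ∧ (L.poly - V ^ 2).natDegree = 5 := by
  have h1 : (V ^ 2).natDegree ≤ 4 := by rw [natDegree_pow]; omega
  have h2 := natDegree_poly L
  have h3 : (V ^ 2).degree < L.poly.degree :=
    degree_lt_degree (by omega)
  exact ⟨L.monic_poly.sub_of_left h3,
    by rw [natDegree_sub_eq_left_of_natDegree_lt (by omega), h2]⟩

theorem monic_sq_mul (a b : ℂ) : (((X - C a) * (X - C b)) ^ 2 : ℂ[X]).Monic :=
  ((monic_X_sub_C a).mul (monic_X_sub_C b)).pow 2

theorem natDegree_sq_mul (a b : ℂ) : (((X - C a) * (X - C b)) ^ 2 : ℂ[X]).natDegree = 4 := by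
  rw [natDegree_pow, (monic_X_sub_C a).natDegree_mul (monic_X_sub_C b), natDegree_X_sub_C,
    natDegree_X_sub_C]

theorem exists_eq_mul_X_sub_C {V : ℂ[X]} (hV : V.natDegree ≤ 2) {a b : ℂ}
    (h : ((X - C a) * (X - C b)) ^ 2 ∣ L.poly - V ^ 2) :
    ∃ e : ℂ, L.poly - V ^ 2 = ((X - C a) * (X - C b)) ^ 2 * (X - C e) := by
  obtain ⟨k, hk⟩ := h
  obtain ⟨h1, h2⟩ := monic_poly_sub_sq (L := L) hV
  rw [hk] at h1 h2
  have h3 := (monic_sq_mul a b).of_mul_monic_left h1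
  rw [(monic_sq_mul a b).natDegree_mul h3, natDegree_sq_mul] at h2
  refine ⟨-k.coeff 0, ?_⟩
  rw [hk, C_neg, sub_neg_eq_add, ← h3.eq_X_add_C (by omega)]

theorem natDegree_cubicPoly (P Q : L.AffinePoint) : (cubicPoly P Q).natDegree = 3 := by
  unfold cubicPoly; compute_degree!

theorem monic_cubicPoly (P Q : L.AffinePoint) : (cubicPoly P Q).Monic := by
  unfold cubicPoly; monicity!

theorem isTorsionDivisor_four_iff {P Q : L.AffinePoint} : IsTorsionDivisor 4 (pair P Q) ↔
    2 • (2 • (P.cls + Q.cls)) = 0 ∧ 2 • (P.cls + Q.cls) ≠ 0 := by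
  rw [IsTorsionDivisor, jacClass_pair, addOrderOf_eq_four_iff]
  simp

section Dedekind

variable [hL : Fact L.Nondegenerate]

theorem two_nsmul_eq_neg_cls_of_graph {P Q E : L.AffinePoint} {V : ℂ[X]}
    (hP : P.y = V.eval P.x) (hQ : Q.y = V.eval Q.x) (hE : E.y = V.eval E.x)
    (h : L.poly - V ^ 2 = ((X - C P.x) * (X - C Q.x)) ^ 2 * (X - C E.x)) :
    2 • (P.cls + Q.cls) = -E.cls := by
  have h1 := sum_cls_eq_zero_of_graph (V := V) (s := {P, P, Q, Q, E})
    (by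
      intro R hR
      simp only [Multiset.insert_eq_cons, Multiset.mem_cons, Multiset.mem_singleton] at hR
      rcases hR with rfl | rfl | rfl | rfl | rfl <;> assumption) one_ne_zero
    (by
      rw [h]
      simp only [Multiset.insert_eq_cons, Multiset.map_cons, Multiset.map_singleton,
        Multiset.prod_cons, Multiset.prod_singleton, C_1]
      ring)
  simp only [Multiset.insert_eq_cons, Multiset.map_cons, Multiset.map_singleton,
        Multiset.sum_cons, Multiset.sum_singleton] at h1
  rw [eq_neg_iff_add_eq_zero, ← h1, two_nsmul]
  abel

/-- If `2 (P + Q)` is special, it is cut out by the graph of a quadratic polynomial. -/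
theorem exists_graph_of_two_nsmul_eq_cls {P Q R : L.AffinePoint}
    (h : 2 • (P.cls + Q.cls) = R.cls) : ∃ V : ℂ[X], V.natDegree ≤ 2 ∧
      V.eval P.x = P.y ∧ V.eval Q.x = Q.y ∧ V.eval R.x = -R.y ∧
      L.poly - V ^ 2 = ((X - C P.x) * (X - C Q.x)) ^ 2 * (X - C R.x) := by
  set s : Multiset L.AffinePoint := {P, P, Q, Q, R.invol} with hs
  have h1 : (s.map AffinePoint.cls).sum = 0 := by
    simp only [hs, Multiset.insert_eq_cons, Multiset.map_cons, Multiset.map_singleton,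
        Multiset.sum_cons, Multiset.sum_singleton]
    rw [R.cls_invol, ← h, two_nsmul]
    abel
  obtain ⟨f, hf⟩ := sum_cls_eq_zero_iff.1 h1
  obtain ⟨a, b, rfl⟩ := exists_func f
  have hw := weight_eq_card hf
  have hev : ∀ T ∈ s, a.eval T.x + b.eval T.x * T.y = 0 := by
    intro T hT
    rw [← AffinePoint.eval_func, ← AffinePoint.mem_ideal_iff, ← pow_one T.ideal,
      ← idealProd_replicate, ← Ideal.span_singleton_le_iff_mem, hf, idealProd_le_iff]
    simpa using hT
  have hcard : Multiset.card s = 5 := rfl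
  rw [hcard, weight] at hw
  -- The weight is 5, which is odd, so `y` must occur; then `b` is a constant and `a` has degree at
  -- most 2.
  have hb : b ≠ 0 := by
    rintro rfl
    simp at hw
    omega
  rw [if_neg hb] at hw
  obtain ⟨β, rfl⟩ := natDegree_eq_zero.1 (show b.natDegree = 0 by omega)
  have hβ : β ≠ 0 := by simpa using hb
  have hdeg : (C (-β⁻¹) * a).natDegree ≤ 2 := natDegree_C_mul_le _ _ |>.trans (by omega)
  have hM : (s.map fun T => X - C T.x).prod =
      ((X - C P.x) * (X - C Q.x)) ^ 2 * (X - C R.x) := by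
    simp only [hs, Multiset.insert_eq_cons, Multiset.map_cons, Multiset.map_singleton,
        Multiset.prod_cons, Multiset.prod_singleton, AffinePoint.invol_x]
    ring
  have heval : ∀ T ∈ s, (C (-β⁻¹) * a).eval T.x = T.y := by
    intro T hT
    have := hev T hT
    rw [eval_C] at this
    rw [eval_mul, eval_C, eq_neg_of_add_eq_zero_left this]
    field_simp
  refine ⟨C (-β⁻¹) * a, hdeg, heval P (by simp [hs]), heval Q (by simp [hs]),
    heval R.invol (by simp [hs]), ?_⟩
  have ha := associated_normPoly hf
  rw [hM] at ha
  refine eq_of_monic_of_associated (monic_poly_sub_sq hdeg).1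
    ((monic_sq_mul _ _).mul (monic_X_sub_C _)) (Associated.trans ?_ ha)
  have e : L.normPoly a (C β) = (L.poly - (C (-β⁻¹) * a) ^ 2) * C (-β ^ 2) := by
    have h2 : (C β⁻¹ * C β : ℂ[X]) = 1 := by rw [← C_mul, inv_mul_cancel₀ hβ, C_1]
    rw [normPoly]
    simp only [C_neg, C_pow]
    linear_combination (-(C β⁻¹ * C β + 1) * a ^ 2) * h2
  rw [e]
  exact associated_mul_unit_right _ _ (isUnit_C.2 (isUnit_iff_ne_zero.2 (by simpa using hβ)))

/-! ### The special case -/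

theorem y_ne_zero_of_two_nsmul_eq_cls {P Q R : L.AffinePoint}
    (h : 2 • (P.cls + Q.cls) = R.cls) : P.y ≠ 0 := by
  intro hP
  rw [nsmul_add, AffinePoint.two_nsmul_cls_eq_zero_iff.2 hP, zero_add, two_nsmul] at h
  exact Q.cls_add_cls_ne_cls Q R h

theorem special_case {P Q : L.AffinePoint} (hx : P.x ≠ Q.x)
    (h : IsSpecial ((2 : ℕ) • jacClass (pair P Q))) :
    (P.y ≠ 0 ∧ Q.y ≠ 0 ∧ den P Q = 0) ∧
      (IsTorsionDivisor 4 (pair P Q) ↔ FourTorsionEqSpecial P Q) := by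
  rw [jacClass_pair] at h
  obtain ⟨R, hR⟩ := isSpecial_iff.1 h
  have hP := y_ne_zero_of_two_nsmul_eq_cls hR
  have hQ := y_ne_zero_of_two_nsmul_eq_cls (add_comm P.cls Q.cls ▸ hR)
  obtain ⟨V, hV, hVP, hVQ, hVR, e⟩ := exists_graph_of_two_nsmul_eq_cls hR
  have hP1 := AffinePoint.eval_derivative_eq_slope hP hVP
    ⟨(X - C Q.x) ^ 2 * (X - C R.x), by rw [e]; ring⟩
  have hQ1 := AffinePoint.eval_derivative_eq_slope hQ hVQ
    ⟨(X - C P.x) ^ 2 * (X - C R.x), by rw [e]; ring⟩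
  obtain ⟨a, b, c, rfl⟩ := exists_eq_quadratic hV
  simp at hVP hVQ hVR hP1 hQ1
  have hx' := sub_ne_zero.2 hx
  have hd : den P Q = 0 := by
    refine (mul_eq_zero.1 ?_).resolve_right hx'
    rw [den_mul_sub P Q hx, ← hVP, ← hVQ, ← hP1, ← hQ1]
    ring
  have g1 : gammaS1 P Q = -a := by
    rw [gammaS1, dbeta3, ← hP1, ← hQ1]
    field_simp
    ring
  have g3 : gammaS3 P Q = -b := by
    rw [gammaS3, show dbeta3 P Q = -2 * a by rw [gammaS1] at g1; linear_combination 2 * g1,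
      beta3, alpha2, ← hVP, ← hVQ]
    field_simp
    ring
  have g5 : gammaS5 P Q = -c := by
    rw [gammaS5, show dbeta3 P Q = -2 * a by rw [gammaS1] at g1; linear_combination 2 * g1,
      beta5, alpha4, ← hVP, ← hVQ]
    field_simp
    ring
  refine ⟨⟨hP, hQ, hd⟩, ?_⟩
  -- This compares the coefficients of `x⁴`, extracted by a fourth central difference at the nodes
  -- `0, ±1, ±2`; hence the factor `1 / 4!`.
  have hxR : 2 * alpha2 P Q + gammaS1 P Q ^ 2 - L.l2 = R.x := by
    have ev : ∀ z : ℂ, _ := fun z => congrArg (eval z) e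
    simp [poly] at ev
    rw [g1, alpha2]
    linear_combination (1 / 24) * (4 * ev 1 + 4 * ev (-1) - ev 2 - ev (-2) - 6 * ev 0)
  -- The condition is now `y_R = 0`. The left side of the equation is `-V(x_R)`, which equals `y_R`.
  rw [isTorsionDivisor_four_iff, hR, AffinePoint.two_nsmul_cls_eq_zero_iff,
    FourTorsionEqSpecial, hxR, g1, g3, g5]
  constructor
  · rintro ⟨h0, -⟩
    linear_combination -hVR + h0
  · intro h0
    exact ⟨by linear_combination hVR + h0, R.cls_ne_zero⟩

/-! ### The non-special case -/

/-- If `Δ = 0`, the graph of `quadPoly` cuts out `2 (P + Q) + E`, and `2 (P + Q)` is equivalent to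
the conjugate of `E`, hence special. -/
theorem den_ne_zero_of_isNonSpecial {P Q : L.AffinePoint} (hx : P.x ≠ Q.x)
    (h : IsNonSpecial (2 • (P.cls + Q.cls))) (hP : P.y ≠ 0) (hQ : Q.y ≠ 0) : den P Q ≠ 0 := by
  intro hd
  have hdeg : (quadPoly P Q).natDegree ≤ 2 := by
    rw [quadPoly, natDegree_neg]
    compute_degree
  obtain ⟨e, he⟩ := exists_eq_mul_X_sub_C hdeg (sq_mul_dvd_poly_sub_sq hx hP hQ
    (eval_quadPoly_left P Q hx) (eval_quadPoly_right P Q hx)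
    (derivative_quadPoly_left P Q hx hd) (derivative_quadPoly_right P Q hx hd))
  have h1 := two_nsmul_eq_neg_cls_of_graph (E := graphPoint (quadPoly P Q) e (by simp [he]))
    (eval_quadPoly_left P Q hx).symm (eval_quadPoly_right P Q hx).symm rfl he
  rw [← AffinePoint.cls_invol] at h1
  exact h.not_isSpecial (isSpecial_iff.2 ⟨_, h1⟩)

/-- If `P` is a branch point, only `2Q` remains; it is reduced unless `Q` is a branch point, so it
is not of order two. -/
theorem y_ne_zero_of_order_four {P Q : L.AffinePoint} (h4 : 2 • (2 • (P.cls + Q.cls)) = 0)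
    (h2 : 2 • (P.cls + Q.cls) ≠ 0) : P.y ≠ 0 := by
  intro hP
  rw [nsmul_add, AffinePoint.two_nsmul_cls_eq_zero_iff.2 hP, zero_add] at h4 h2
  have hQ : Q.y ≠ 0 := fun h => h2 (AffinePoint.two_nsmul_cls_eq_zero_iff.2 h)
  rw [two_nsmul Q.cls, AffinePoint.two_nsmul_cls_add_cls_eq_zero_iff
    (fun h => hQ (Q.invol_eq_self_iff.1 h.symm))] at h4
  exact hQ h4.1

/-- The zeros of `x³ + γ₁ y + γ₂ x² + γ₄ x + γ₆` away from `2 (P + Q)`. -/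
theorem exists_residual_points {P Q : L.AffinePoint} (hx : P.x ≠ Q.x) (hP : P.y ≠ 0)
    (hQ : Q.y ≠ 0) (hd : den P Q ≠ 0) : ∃ E F : L.AffinePoint,
      2 • (P.cls + Q.cls) = -(E.cls + F.cls) ∧
      gamma1 P Q * E.y = -(cubicPoly P Q).eval E.x ∧
      gamma1 P Q * F.y = -(cubicPoly P Q).eval F.x ∧
      -(E.x + F.x) = 2 * gamma2 P Q - gamma1 P Q ^ 2 - 2 * alpha2 P Q ∧
      E.x * F.x = -2 * alpha4 P Q +
        (3 * alpha2 P Q - gamma2 P Q) * (alpha2 P Q - gamma2 P Q) +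
        gamma1 P Q ^ 2 * (2 * alpha2 P Q - L.l2) + 2 * gamma4 P Q := by
  have hg := gamma1_ne_zero P Q hx hd
  set V : ℂ[X] := C (-(gamma1 P Q)⁻¹) * cubicPoly P Q with hV
  have hV1 : V.eval P.x = P.y := by
    rw [hV, eval_mul, eval_C, eval_cubicPoly_left P Q hx]; field_simp
  have hV2 : V.eval Q.x = Q.y := by
    rw [hV, eval_mul, eval_C, eval_cubicPoly_right P Q hx]; field_simp
  have hdvd := sq_mul_dvd_poly_sub_sq hx hP hQ hV1 hV2
    (by rw [hV, derivative_C_mul, eval_mul, eval_C, derivative_cubicPoly_left P Q hx hd]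
        field_simp)
    (by rw [hV, derivative_C_mul, eval_mul, eval_C, derivative_cubicPoly_right P Q hx hd]
        field_simp)
  have hunit : (C (gamma1 P Q)⁻¹ * C (gamma1 P Q) : ℂ[X]) = 1 := by
    rw [← C_mul, inv_mul_cancel₀ hg, C_1]
  have e : cubicPoly P Q ^ 2 - C (gamma1 P Q ^ 2) * L.poly =
      (L.poly - V ^ 2) * C (-gamma1 P Q ^ 2) := by
    rw [hV]
    simp only [C_neg, C_pow]
    linear_combination (-(C (gamma1 P Q)⁻¹ * C (gamma1 P Q) + 1) * cubicPoly P Q ^ 2) * hunit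
  have e' : L.poly - V ^ 2 = C (-(gamma1 P Q ^ 2)⁻¹) *
      (cubicPoly P Q ^ 2 - C (gamma1 P Q ^ 2) * L.poly) := by
    rw [e, mul_comm, mul_assoc, ← C_mul]
    have : -gamma1 P Q ^ 2 * -(gamma1 P Q ^ 2)⁻¹ = 1 := by field_simp
    rw [this, C_1, mul_one]
  obtain ⟨k, hk⟩ : ((X - C P.x) * (X - C Q.x)) ^ 2 ∣
      cubicPoly P Q ^ 2 - C (gamma1 P Q ^ 2) * L.poly := by
    rw [e]; exact hdvd.mul_right _
  have hdeg6 : (cubicPoly P Q ^ 2).natDegree = 6 := by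
    rw [natDegree_pow, natDegree_cubicPoly]
  have hdeg5 : (C (gamma1 P Q ^ 2) * L.poly).natDegree = 5 := by
    rw [natDegree_C_mul (pow_ne_zero 2 hg), natDegree_poly]
  have hm : (cubicPoly P Q ^ 2 - C (gamma1 P Q ^ 2) * L.poly).Monic :=
    ((monic_cubicPoly P Q).pow 2).sub_of_left (degree_lt_degree (by omega))
  have hdeg : (cubicPoly P Q ^ 2 - C (gamma1 P Q ^ 2) * L.poly).natDegree = 6 := by
    rw [natDegree_sub_eq_left_of_natDegree_lt (by omega), hdeg6]
  rw [hk] at hm hdeg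
  have hkm := (monic_sq_mul _ _).of_mul_monic_left hm
  rw [(monic_sq_mul _ _).natDegree_mul hkm, natDegree_sq_mul] at hdeg
  obtain ⟨u, v, w, hk2⟩ := exists_eq_quadratic (p := k) (by omega)
  have hu : u = 1 := by
    have h1 : k.coeff 2 = 1 := by
      have := hkm.coeff_natDegree
      rwa [show k.natDegree = 2 by omega] at this
    rw [← h1, hk2]
    simp
  obtain ⟨q₁, q₂, hq1, hq2⟩ := exists_quadratic_factors v w
  have hk3 : k = (X - C q₁) * (X - C q₂) := by
    rw [hk2, hu, hq1, hq2]
    simp only [C_1, C_neg, C_add, C_mul]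
    ring
  have hfin : L.poly - V ^ 2 = C (-(gamma1 P Q ^ 2)⁻¹) *
      (((X - C P.x) * (X - C Q.x)) ^ 2 * ((X - C q₁) * (X - C q₂))) := by
    rw [e', hk, hk3]
  set E : L.AffinePoint := graphPoint V q₁ (by simp [hfin])
  set F : L.AffinePoint := graphPoint V q₂ (by simp [hfin])
  have hEx : E.x = q₁ := rfl
  have hFx : F.x = q₂ := rfl
  have hEy : E.y = V.eval E.x := rfl
  have hFy : F.y = V.eval F.x := rfl
  rw [hk3] at hk
  have ev : ∀ z : ℂ, _ := fun z => congrArg (eval z) hk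
  simp [poly, cubicPoly] at ev
  -- This compares the coefficients of `x⁵` by a fifth difference at `-2, ..., 3`, with factor `1 /
  -- 5!`; both sides are monic of degree 6, so the top terms cancel.
  have c5 : -(q₁ + q₂) = 2 * gamma2 P Q - gamma1 P Q ^ 2 - 2 * alpha2 P Q := by
    rw [alpha2]
    linear_combination (-1 / 120) * (ev 3 - 5 * ev 2 + 10 * ev 1 - 10 * ev 0 + 5 * ev (-1) -
      ev (-2))
  refine ⟨E, F, ?_, ?_, ?_, c5, ?_⟩
  · have h1 := sum_cls_eq_zero_of_graph (V := V) (s := {P, P, Q, Q, E, F})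
      (by
        intro R hR
        simp only [Multiset.insert_eq_cons, Multiset.mem_cons, Multiset.mem_singleton] at hR
        rcases hR with rfl | rfl | rfl | rfl | rfl | rfl
        exacts [hV1.symm, hV1.symm, hV2.symm, hV2.symm, rfl, rfl])
      (c := -(gamma1 P Q ^ 2)⁻¹) (neg_ne_zero.2 (inv_ne_zero (pow_ne_zero 2 hg)))
      (by
        rw [hfin]
        simp only [Multiset.insert_eq_cons, Multiset.map_cons, Multiset.map_singleton,
          Multiset.prod_cons, Multiset.prod_singleton, hEx, hFx]
        ring)
    simp only [Multiset.insert_eq_cons, Multiset.map_cons, Multiset.map_singleton,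
        Multiset.sum_cons, Multiset.sum_singleton] at h1
    rw [eq_neg_iff_add_eq_zero, ← h1, two_nsmul]
    abel
  · rw [hEy, hV, eval_mul, eval_C]; field_simp
  · rw [hFy, hV, eval_mul, eval_C]; field_simp
  · rw [hEx, hFx, alpha4]
    rw [alpha2] at c5 ⊢
    -- The coefficients of `x⁴`, by a fourth difference; the sum of the residual abscissae is then
    -- eliminated with `c5`.
    linear_combination (-1 / 24) * (ev 2 - 4 * ev 1 + 6 * ev 0 - 4 * ev (-1) + ev (-2)) +
      2 * (P.x + Q.x) * c5

theorem nonspecial_case {P Q : L.AffinePoint} (hx : P.x ≠ Q.x)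
    (h : IsNonSpecial ((2 : ℕ) • jacClass (pair P Q))) :
    (P.y ≠ 0 → Q.y ≠ 0 → den P Q ≠ 0) ∧
      (IsTorsionDivisor 4 (pair P Q) ↔ P.y ≠ 0 ∧ Q.y ≠ 0 ∧ FourTorsionEqs P Q) := by
  rw [jacClass_pair] at h
  refine ⟨den_ne_zero_of_isNonSpecial hx h, ?_⟩
  have key : P.y ≠ 0 → Q.y ≠ 0 →
      (2 • (2 • (P.cls + Q.cls)) = 0 ↔ FourTorsionEqs P Q) := by
    intro hP hQ
    have hd := den_ne_zero_of_isNonSpecial hx h hP hQ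
    have hg := gamma1_ne_zero P Q hx hd
    obtain ⟨E, F, h1, hE, hF, h5, h4⟩ := exists_residual_points hx hP hQ hd
    have hEF : F ≠ E.invol := by
      intro h2
      refine h.ne_zero ?_
      rw [h1, AffinePoint.cls_add_cls_eq_zero_iff.2 h2, neg_zero]
    have hneg : (2 : ℕ) • ((2 : ℕ) • (P.cls + Q.cls)) = -((2 : ℕ) • (E.cls + F.cls)) := by
      rw [h1, two_nsmul, two_nsmul]
      abel
    rw [hneg, neg_eq_zero, AffinePoint.two_nsmul_cls_add_cls_eq_zero_iff hEF, FourTorsionEqs]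
    have hE' : E.y = 0 ↔ (cubicPoly P Q).eval E.x = 0 := by
      rw [← neg_eq_zero (a := (cubicPoly P Q).eval E.x), ← hE]; simp [hg]
    have hF' : F.y = 0 ↔ (cubicPoly P Q).eval F.x = 0 := by
      rw [← neg_eq_zero (a := (cubicPoly P Q).eval F.x), ← hF]; simp [hg]
    -- Coinciding branch points would be conjugate, which would make the class of `2D` trivial.
    have hne : E.y = 0 → F.y = 0 → E.x - F.x ≠ 0 := by
      intro h2 h3 h6
      exact hEF (AffinePoint.ext (sub_eq_zero.1 h6).symm (by simp [h2, h3]))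
    rw [hE', hF'] at hne ⊢
    rw [← h4]
    simp only [cubicPoly, eval_add, eval_mul, eval_pow, eval_X, eval_C] at hne ⊢
    set a2 := alpha2 P Q
    set a4 := alpha4 P Q
    set g1 := gamma1 P Q
    set g2 := gamma2 P Q
    set g4 := gamma4 P Q
    set g6 := gamma6 P Q
    set l2 := L.l2
    -- The two equations say that `(x - x_E)(x - x_F)` divides the cubic with quotient `x + γ₂ + x_E
    -- + x_F`: they compare the coefficient of `x` and the constant term. For distinct abscissae
    -- this is the vanishing of the cubic at both.
    have r1 : -2 * a4 - a2 ^ 2 + (2 * a2 - g2 + g1 ^ 2) * (g2 - g1 ^ 2) + g1 ^ 2 * (g2 - l2) + g4 =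
        -(g4 - E.x * F.x + (E.x + F.x) * (g2 + (E.x + F.x))) := by
      rw [h4, show E.x + F.x = -(2 * g2 - g1 ^ 2 - 2 * a2) by rw [← h5]; ring]
      ring
    have r0 : 2 * a2 - g2 + g1 ^ 2 = g2 + (E.x + F.x) := by
      linear_combination h5
    rw [r1, r0]
    constructor
    · rintro ⟨h2, h3⟩
      have h6 := hne h2 h3
      have h7 : g4 - E.x * F.x + (E.x + F.x) * (g2 + (E.x + F.x)) = 0 := by
        refine (mul_eq_zero.1 ?_).resolve_left h6
        linear_combination h2 - h3
      refine ⟨by rw [h7, neg_zero], ?_⟩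
      linear_combination -h2 + E.x * h7
    · rintro ⟨h2, h3⟩
      exact ⟨by linear_combination -h3 - E.x * h2, by linear_combination -h3 - F.x * h2⟩
  rw [isTorsionDivisor_four_iff]
  constructor
  · rintro ⟨h1, h2⟩
    have hP := y_ne_zero_of_order_four h1 h2
    have hQ : Q.y ≠ 0 := by
      rw [add_comm P.cls] at h1 h2
      exact y_ne_zero_of_order_four h1 h2
    exact ⟨hP, hQ, (key hP hQ).1 h1⟩
  · rintro ⟨hP, hQ, h1⟩
    exact ⟨(key hP hQ).2 h1, h.ne_zero⟩

theorem existsUnique_isNonSpecialDivisor {c : L.Jac} (hc : addOrderOf c = 4) :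
    ∃! D : L.Divisor, IsNonSpecialDivisor D ∧ jacClass D = c := by
  obtain ⟨D, hD, rfl⟩ := isNonSpecial_of_addOrderOf_eq_four hc
  exact ⟨D, ⟨hD, rfl⟩, fun E hE => hE.1.eq_of_jacClass_eq hD hE.2⟩

end Dedekind

/-- Points of order four of the Jacobian, counted by characteristics. -/
theorem ncard_characteristic (u : Characteristic ≃+ L.Jac) (p : L.Jac → Prop) :
    Set.ncard {ε : Characteristic | addOrderOf ε = 4 ∧ p (u ((2 : ℕ) • ε))} =
      Set.ncard {c : L.Jac | addOrderOf c = 4 ∧ p ((2 : ℕ) • c)} := by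
  have h : {ε : Characteristic | addOrderOf ε = 4 ∧ p (u ((2 : ℕ) • ε))} =
      u ⁻¹' {c : L.Jac | addOrderOf c = 4 ∧ p ((2 : ℕ) • c)} := by
    ext ε
    simp only [Set.mem_ofPred_eq, Set.mem_preimage, map_nsmul]
    rw [addOrderOf_injective u.toAddMonoidHom u.injective ε |>.symm]
    rfl
  rw [h, Set.ncard_preimage_of_injective_subset_range u.injective]
  rw [u.surjective.range_eq]
  exact Set.subset_univ _

end

end Genus2

theorem mainTheorem5 (L : Genus2) (hL : L.Nondegenerate) :
    -- distinct points, `2D` non-special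
    (∀ P Q : L.AffinePoint, P.x ≠ Q.x →
      Genus2.IsNonSpecial ((2 : ℕ) • Genus2.jacClass (Genus2.pair P Q)) →
      (P.y ≠ 0 → Q.y ≠ 0 → Genus2.den P Q ≠ 0) ∧
      (Genus2.IsTorsionDivisor 4 (Genus2.pair P Q) ↔
        P.y ≠ 0 ∧ Q.y ≠ 0 ∧ Genus2.FourTorsionEqs P Q)) ∧
    -- distinct points, `2D` special
    (∀ P Q : L.AffinePoint, P.x ≠ Q.x →
      Genus2.IsSpecial ((2 : ℕ) • Genus2.jacClass (Genus2.pair P Q)) →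
      (P.y ≠ 0 ∧ Q.y ≠ 0 ∧ Genus2.den P Q = 0) ∧
      (Genus2.IsTorsionDivisor 4 (Genus2.pair P Q) ↔ Genus2.FourTorsionEqSpecial P Q)) ∧
    -- every point of order 4 comes from exactly one non-special divisor, and falls in one of the
    -- two cases
    (∀ c : L.Jac, addOrderOf c = 4 →
      (∃! D : L.Divisor, Genus2.IsNonSpecialDivisor D ∧ Genus2.jacClass D = c) ∧
      (Genus2.IsNonSpecial ((2 : ℕ) • c) ∨ Genus2.IsSpecial ((2 : ℕ) • c)) ∧
      ¬(Genus2.IsNonSpecial ((2 : ℕ) • c) ∧ Genus2.IsSpecial ((2 : ℕ) • c))) ∧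
    -- the numbers of points of order 4
    Set.ncard {c : L.Jac | addOrderOf c = 4} = 240 ∧
    Set.ncard {c : L.Jac | addOrderOf c = 4 ∧ Genus2.IsNonSpecial ((2 : ℕ) • c)} = 160 ∧
    Set.ncard {c : L.Jac | addOrderOf c = 4 ∧ Genus2.IsSpecial ((2 : ℕ) • c)} = 80 ∧
    -- the same numbers in terms of characteristics
    (∀ u : Genus2.Characteristic ≃+ L.Jac,
      Set.ncard {ε : Genus2.Characteristic | addOrderOf ε = 4} = 240 ∧
      Set.ncard {ε : Genus2.Characteristic |
        addOrderOf ε = 4 ∧ Genus2.IsNonSpecial (u ((2 : ℕ) • ε))} = 160 ∧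
      Set.ncard {ε : Genus2.Characteristic |
        addOrderOf ε = 4 ∧ Genus2.IsSpecial (u ((2 : ℕ) • ε))} = 80) := by
  have : Fact L.Nondegenerate := ⟨hL⟩
  refine ⟨fun P Q hx h => Genus2.nonspecial_case hx h, fun P Q hx h => Genus2.special_case hx h,
    fun c hc => ⟨Genus2.existsUnique_isNonSpecialDivisor hc,
      Genus2.isNonSpecial_or_isSpecial_of_addOrderOf_eq_four hc,
      fun h => h.1.not_isSpecial h.2⟩,
    L.ncard_order_four, L.ncard_order_four_isNonSpecial, L.ncard_order_four_isSpecial,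
    fun u => ⟨?_, ?_, ?_⟩⟩
  · simpa [L.ncard_order_four] using Genus2.ncard_characteristic u (fun _ => True)
  · rw [Genus2.ncard_characteristic u Genus2.IsNonSpecial, L.ncard_order_four_isNonSpecial]
  · rw [Genus2.ncard_characteristic u Genus2.IsSpecial, L.ncard_order_four_isSpecial]
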